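/- **Setting.** Let $(\Omega,\mathcal A,\mathbb P)$ be a probability space and let $(T_x)_{x\in\mathbb Z}$ be a group of measure-preserving transformations of $\Omega$ ($T_0=\mathrm{id}$, $T_{x+y}=T_xT_y$) acting ergodically: every event $A$ with $T_x^{-1}A=A$ for all $x$ has probability $0$ or $1$. Let $H(\omega)$, $\omega\in\Omega$, be an ergodic operator on $\ell^2(\mathbb Z)$ with respect to the shifts, that is: each $H(\omega)$ is a self-adjoint (possibly unbounded) operator on $\ell^2(\mathbb Z)$; $\omega\mapsto H(\omega)$ is weakly measurable (the functions $\omega\mapsto\langle\varphi,f(H(\omega))\psi\rangle$ are $\mathbb P$-measurable for all $\varphi,\psi\in\ell^2(\mathbb Z)$ and all $f \in C_0(\mathbb R)$, equivalently for all bounded Borel $f$); and for all $x\in\mathbb Z$, $\omega\in\Omega$ one has $H(T_x\omega)=U_{x,\omega}H(\omega)U_{x,\omega}^\dagger$ with a unitary operator of the form $(U_{x,\omega}\psi)(\xi)=\psi(\xi-x)e^{i\phi_{x,\omega}(\xi)}$ with real phases $\phi_{x,\omega}(\xi)$. Assume that every unit vector $\delta_x$, $x\in\mathbb Z$, lies in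 the domain of every $H(\omega)$ (automatic if $H(\omega)$ is bounded). For integers $L\ge 1$ let $\Lambda_L=[-L,L]\cap\mathbb Z$, $|\Lambda_L|=2L+1$, and $H_L(\omega)=1_{\Lambda_L}H(\omega)1_{\Lambda_L}$, a bounded self-adjoint operator on $\ell^2(\mathbb Z)$. The *density of states measure of* $H_L(\omega)$ is the Radon measure $k_{\omega,L}$ on $\mathbb R$ with $$\int g\,dk_{\omega,L}=\frac1{|\Lambda_L|}\sum_{x\in\Lambda_L}\langle\delta_x,g(H_L(\omega))\delta_x\rangle\qquad\text{for all } g\in C_c(\mathbb R),$$ and the *density of states measure* is the Radon measure $k$ on $\mathbb R$ with $\int g\,dk=\mathbb E\langle\delta_0,g(H(\omega))\delta_0\rangle$ for all $g\in C_c(\mathbb R)$. **Theorem.** Suppose that $H_L(\omega)-1_{\Lambda_L}H(\omega)$ is trace class (i.e. extends from its dense domain to a trace-class operator on $\ell^2(\mathbb Z)$) for all $\omega\in\Omega$ and $L\ge1$, and that $$\operatorname{tr}\bigl|H_L(\omega)-1_{\Lambda_L}H(\omega)\bigr|\le\varepsilon(L)\,|\Lambda_L|,$$ where $\varepsilon(L)\to0$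 as $L\to\infty$. Then the measures $k$ and $k_{\omega,L}$ exist, are unique and are probability measures, $\omega\mapsto\langle\delta_0,g(H(\omega))\delta_0\rangle$ is integrable for every $g\in C_0(\mathbb R)$, and there is a measurable set $\Omega_0\subset\Omega$ with $\mathbb P(\Omega_0)=1$ such that for every $\omega\in\Omega_0$: 1. for all complex-valued $g\in C_0(\mathbb R)$ (continuous functions vanishing at infinity), $$\lim_{L\to\infty}\frac1{|\Lambda_L|}\sum_{x\in\Lambda_L}\langle\delta_x,g(H_L(\omega))\delta_x\rangle=\mathbb E\bigl(\langle\delta_0,g(H(\omega))\delta_0\rangle\bigr);$$ 2. $k_{\omega,L}$ converges weakly to $k$, i.e. $\lim_{L\to\infty}\int f\,dk_{\omega,L}=\int f\,dk$ for all bounded continuous $f:\mathbb R\to\mathbb C$. -/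

import Mathlib

open MeasureTheory Filter Topology
open scoped ZeroAtInfty CompactlySupported BoundedContinuousFunction InnerProductSpace

/-! ### Unbounded self-adjoint operators and their functions -/

section FunctionalCalculus

variable {E : Type*} [NormedAddCommGroup E] [InnerProductSpace ℂ E]

/-- `R` is the resolvent `(A - z)⁻¹` of the (possibly unbounded) operator `A`: it is a bounded
two-sided inverse of `A - z : D(A) → E`. -/
def IsResolventAt (A : E →ₗ.[ℂ] E) (z : ℂ) (R : E →L[ℂ] E) : Prop :=
  (∀ ψ : E, ∃ h : R ψ ∈ A.domain, A ⟨R ψ, h⟩ - z • R ψ = ψ) ∧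
    ∀ ψ : A.domain, R (A ψ - z • (ψ : E)) = ψ

theorem IsResolventAt.unique {A : E →ₗ.[ℂ] E} {z : ℂ} {R R' : E →L[ℂ] E}
    (h : IsResolventAt A z R) (h' : IsResolventAt A z R') : R = R' := by
  ext ψ
  obtain ⟨hd, he⟩ := h.1 ψ
  have := h'.2 ⟨R ψ, hd⟩
  simp only [he] at this
  exact this.symm

/-- A self-adjoint operator has a resolvent at `i`. -/
theorem exists_isResolventAt_I [CompleteSpace E] {A : E →ₗ.[ℂ] E} (hA : IsSelfAdjoint A) :
    ∃ R : E →L[ℂ] E, IsResolventAt A Complex.I R := by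
  have hd := hA.dense_domain
  have hadj : A.adjoint = A := hA
  have hsym : ∀ x y : A.domain, ⟪A x, (y : E)⟫_ℂ = ⟪(x : E), A y⟫_ℂ := by
    have := LinearPMap.adjoint_isFormalAdjoint hd
    rw [hadj] at this
    exact this
  have hcl : IsClosed (A.graph : Set (E × E)) := by
    have := LinearPMap.adjoint_isClosed hd
    rw [hadj] at this
    exact this
  have hnorm : ∀ x : A.domain, ‖A x - Complex.I • (x : E)‖ ^ 2 = ‖A x‖ ^ 2 + ‖(x : E)‖ ^ 2 := by
    intro x
    have him : (⟪A x, (x : E)⟫_ℂ).im = 0 := by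
      rw [← Complex.conj_eq_iff_im, inner_conj_symm, hsym]
    rw [@norm_sub_sq ℂ]
    simp [inner_smul_right, norm_smul, him]
  let M : A.domain →ₗ[ℂ] E := A.toFun - Complex.I • A.domain.subtype
  have hM : ∀ x : A.domain, M x = A x - Complex.I • (x : E) := fun x => rfl
  have hbd : ∀ x : A.domain, ‖(x : E)‖ ≤ ‖M x‖ := by
    intro x
    have := hnorm x
    rw [← hM] at this
    exact abs_le_of_sq_le_sq' (by nlinarith [sq_nonneg ‖A x‖]) (norm_nonneg _) |>.2
  have hbd' : ∀ x : A.domain, ‖A x‖ ≤ ‖M x‖ := by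
    intro x
    have := hnorm x
    rw [← hM] at this
    exact abs_le_of_sq_le_sq' (by nlinarith [sq_nonneg ‖(x : E)‖]) (norm_nonneg _) |>.2
  have hinj : Function.Injective M := by
    rw [← LinearMap.ker_eq_bot, LinearMap.ker_eq_bot']
    intro x hx
    have := hbd x
    rw [hx, norm_zero] at this
    exact Subtype.ext (norm_le_zero_iff.1 this)
  have hrange : IsClosed (LinearMap.range M : Set E) := by
    have : CompleteSpace A.graph := hcl.completeSpace_coe
    let N : A.graph →L[ℂ] E :=
      (ContinuousLinearMap.snd ℂ E E - Complex.I • ContinuousLinearMap.fst ℂ E E).comp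
        A.graph.subtypeL
    have hN : ∀ p : A.graph, N p = p.1.2 - Complex.I • p.1.1 := fun p => rfl
    have hanti : AntilipschitzWith 1 N := by
      refine AddMonoidHomClass.antilipschitz_of_bound N fun p => ?_
      obtain ⟨x, hx1, hx2⟩ := (LinearPMap.mem_graph_iff A).1 p.2
      have hNp : N p = M x := by rw [hN, hM, hx1, hx2]
      rw [hNp, NNReal.coe_one, one_mul, Submodule.coe_norm, Prod.norm_def, ← hx1, ← hx2]
      exact max_le (hbd x) (hbd' x)
    have hr := hanti.isClosed_range N.uniformContinuous
    convert hr using 1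
    ext y
    constructor
    · rintro ⟨x, rfl⟩
      exact ⟨⟨(x, A x), LinearPMap.mem_graph A x⟩, rfl⟩
    · rintro ⟨p, rfl⟩
      obtain ⟨x, hx1, hx2⟩ := (LinearPMap.mem_graph_iff A).1 p.2
      exact ⟨x, by rw [hN, hM, hx1, hx2]⟩
  have hperp : (LinearMap.range M)ᗮ = ⊥ := by
    rw [Submodule.eq_bot_iff]
    intro y hy
    have h1 : ∀ x : A.domain, ⟪-Complex.I • y, (x : E)⟫_ℂ = ⟪y, A x⟫_ℂ := by
      intro x
      have := (Submodule.mem_orthogonal' _ _).1 hy (M x) ⟨x, rfl⟩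
      rw [hM, inner_sub_right, inner_smul_right, sub_eq_zero] at this
      rw [this, inner_smul_left]
      simp
    have hyd : y ∈ A.adjoint.domain := LinearPMap.mem_adjoint_domain_of_exists y ⟨_, h1⟩
    have hye := LinearPMap.adjoint_apply_eq hd ⟨y, hyd⟩ h1
    obtain ⟨hyA, hAy⟩ : ∃ h : y ∈ A.domain, A ⟨y, h⟩ = -Complex.I • y := by
      have key : ∀ B : E →ₗ.[ℂ] E, B = A → ∀ h : y ∈ B.domain, B ⟨y, h⟩ = -Complex.I • y →
          ∃ h : y ∈ A.domain, A ⟨y, h⟩ = -Complex.I • y := by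
        rintro B rfl h h'
        exact ⟨h, h'⟩
      exact key _ hadj hyd hye
    have := (Submodule.mem_orthogonal' _ _).1 hy (M ⟨y, hyA⟩) ⟨_, rfl⟩
    rw [hM, hAy, ← sub_smul, inner_smul_right] at this
    have h2 : (-Complex.I - Complex.I) ≠ 0 := by
      intro h
      have := congrArg Complex.im h
      norm_num at this
    exact inner_self_eq_zero.1 ((mul_eq_zero.1 this).resolve_left h2)
  have hsurj : Function.Surjective M := by
    have : CompleteSpace (LinearMap.range M) := hrange.completeSpace_coe
    rw [← LinearMap.range_eq_top]
    exact Submodule.orthogonal_eq_bot_iff.1 hperp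
  let e := LinearEquiv.ofBijective M ⟨hinj, hsurj⟩
  have he : ∀ ψ, M (e.symm ψ) = ψ := fun ψ => e.apply_symm_apply ψ
  refine ⟨(A.domain.subtype ∘ₗ e.symm.toLinearMap).mkContinuous 1 fun ψ => ?_, fun ψ => ?_,
    fun ψ => ?_⟩
  · have := hbd (e.symm ψ)
    rw [he] at this
    simpa using this
  · exact ⟨(e.symm ψ).2, he ψ⟩
  · exact congrArg Subtype.val (e.symm_apply_apply ψ)

open Classical in
/-- The resolvent `(A - z)⁻¹` as a bounded operator (and `0` if `z` is not in the resolvent set). -/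
noncomputable def resolventAt (A : E →ₗ.[ℂ] E) (z : ℂ) : E →L[ℂ] E :=
  if h : ∃ R : E →L[ℂ] E, IsResolventAt A z R then h.choose else 0

theorem isResolventAt_resolventAt_I [CompleteSpace E] {A : E →ₗ.[ℂ] E} (hA : IsSelfAdjoint A) :
    IsResolventAt A Complex.I (resolventAt A Complex.I) := by
  have h := exists_isResolventAt_I hA
  rw [resolventAt, dif_pos h]
  exact h.choose_spec

/-- The bounded operator `g(A)` for a self-adjoint, possibly unbounded, operator `A` and a
continuous `g : ℝ → ℂ` that vanishes at infinity. The resolvent `w = (A - i)⁻¹` is a bounded normal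
operator and `A = Re (1 / w)`, so `g(A)` is the value at `(A - i)⁻¹` of the continuous function
`w ↦ g (Re (1 / w))`, extended by `0` to `w = 0` (the image of `∞`), in the continuous functional
calculus of bounded normal operators. -/
noncomputable def applyFun [CompleteSpace E] (g : ℝ → ℂ) (A : E →ₗ.[ℂ] E) : E →L[ℂ] E :=
  cfc (fun w : ℂ => if w = 0 then 0 else g (w⁻¹).re) (resolventAt A Complex.I)

/-- `|T| = (T† T)^{1/2}` for a bounded operator `T`. -/
noncomputable def absOp [CompleteSpace E] (T : E →L[ℂ] E) : E →L[ℂ] E := CFC.abs T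

/-- The composition `A B` of a partially defined `A` with an everywhere defined `B`, with its
natural domain `{ψ | B ψ ∈ D(A)}`. -/
def LinearPMap.compLin (A : E →ₗ.[ℂ] E) (B : E →ₗ[ℂ] E) : E →ₗ.[ℂ] E where
  domain := A.domain.comap B
  toFun := A.toFun ∘ₗ B.restrict (fun _ h => h)

end FunctionalCalculus

/-! ### The space `ℓ²(ℤ)`, truncations, trace norm -/

/-- The Hilbert space `ℓ²(ℤ)`. -/
abbrev EllTwo : Type := lp (fun _ : ℤ => ℂ) 2

/-- The unit vector `δ_x`. -/
noncomputable def deltaVec (x : ℤ) : EllTwo := lp.single 2 x (1 : ℂ)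

/-- The box `Λ_L = [-L, L] ∩ ℤ`. -/
noncomputable def box (L : ℕ) : Finset ℤ := Finset.Icc (-(L : ℤ)) L

/-- Multiplication by the characteristic function of `Λ_L` on `ℓ²(ℤ)`. -/
noncomputable def boxProj (L : ℕ) : EllTwo →ₗ[ℂ] EllTwo :=
  ∑ x ∈ box L, lp.lsingle 2 x ∘ₗ lp.evalₗ (𝕜 := ℂ) (fun _ : ℤ => ℂ) 2 x

theorem boxProj_apply (L : ℕ) (ψ : EllTwo) (n : ℤ) :
    boxProj L ψ n = if n ∈ box L then ψ n else 0 := by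
  simp only [boxProj, LinearMap.sum_apply]
  rw [lp.coeFn_sum, Finset.sum_apply]
  simp only [LinearMap.comp_apply]
  change ∑ c ∈ box L, (Pi.single c (ψ c) : ℤ → ℂ) n = _
  simp [Pi.single_apply]

/-- The truncated operator `H_L = 1_{Λ_L} H 1_{Λ_L}` on `ℓ²(ℤ)`. -/
noncomputable def truncation (H : EllTwo →ₗ.[ℂ] EllTwo) (L : ℕ) : EllTwo →ₗ.[ℂ] EllTwo :=
  (boxProj L).compPMap (H.compLin (boxProj L))

/-- The bounded operator `T` is trace class: `tr |T| < ∞`. -/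
def IsTraceClass (T : EllTwo →L[ℂ] EllTwo) : Prop :=
  Summable fun x : ℤ => (⟪deltaVec x, absOp T (deltaVec x)⟫_ℂ).re

/-- The trace norm `tr |T| = ∑ₓ ⟨δ_x, |T| δ_x⟩`. -/
noncomputable def trAbs (T : EllTwo →L[ℂ] EllTwo) : ℝ :=
  ∑' x : ℤ, (⟪deltaVec x, absOp T (deltaVec x)⟫_ℂ).re

/-- The densely defined operator `D` is trace class with `tr |D| ≤ c`: it has a (necessarily unique)
bounded extension `T` to `ℓ²(ℤ)` with these properties. -/
def TraceClassWithBound (D : EllTwo →ₗ.[ℂ] EllTwo) (c : ℝ) : Prop :=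
  Dense (D.domain : Set EllTwo) ∧
    ∃ T : EllTwo →L[ℂ] EllTwo, (∀ ψ : D.domain, T ψ = D ψ) ∧ IsTraceClass T ∧ trAbs T ≤ c

/-! ### Ergodic operators -/

/-- A self-adjoint random operator on `ℓ²(ℤ)`: every `H ω` is self-adjoint and all matrix elements
`ω ↦ ⟨φ, f(H ω) ψ⟩` are `P`-measurable. It is enough to demand this for `f ∈ C₀(ℝ)`; measurability
for all bounded Borel functions `f` follows by a monotone class argument. -/
structure IsRandomOperator {Ω : Type*} [MeasurableSpace Ω] (P : Measure Ω)
    (H : Ω → (EllTwo →ₗ.[ℂ] EllTwo)) : Prop where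
  selfAdjoint : ∀ ω, IsSelfAdjoint (H ω)
  weaklyMeasurable : ∀ (f : C₀(ℝ, ℂ)) (φ ψ : EllTwo),
    AEMeasurable (fun ω => ⟪φ, applyFun f (H ω) ψ⟫_ℂ) P

/-- `(T_x)_{x ∈ ℤ}` is a group of measure-preserving transformations acting ergodically on
`(Ω, P)`. -/
structure IsErgodicShiftGroup {Ω : Type*} [MeasurableSpace Ω] (P : Measure Ω)
    (T : ℤ → Ω → Ω) : Prop where
  map_zero : ∀ ω, T 0 ω = ω
  map_add : ∀ x y ω, T (x + y) ω = T x (T y ω)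
  measurePreserving : ∀ x, MeasurePreserving (T x) P P
  ergodic : ∀ A : Set Ω, MeasurableSet A → (∀ x, T x ⁻¹' A = A) → P A = 0 ∨ P A = 1

/-- The (standard) ergodic operators on `ℓ²(ℤ)`, with `ℤ` endowed with the shifts
`S_x n = n - x`: a self-adjoint random operator with `H (T_x ω) = U H(ω) U†` for unitary operators
`U = U_{x, ω}` of the form `(U ψ)(ξ) = ψ(S_x ξ) e^{i φ(ξ)}`. -/
structure IsErgodicOperator {Ω : Type*} [MeasurableSpace Ω] (P : Measure Ω) (T : ℤ → Ω → Ω)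
    (H : Ω → (EllTwo →ₗ.[ℂ] EllTwo)) : Prop extends
    IsRandomOperator P H, IsErgodicShiftGroup P T where
  covariant : ∀ (x : ℤ) (ω : Ω), ∃ (U : EllTwo ≃ₗᵢ[ℂ] EllTwo) (φ : ℤ → ℝ),
    (∀ (ψ : EllTwo) (ξ : ℤ), U ψ ξ = ψ (ξ - x) * Complex.exp (Complex.I * φ ξ)) ∧
      H (T x ω) =
        U.toLinearEquiv.toLinearMap.compPMap ((H ω).compLin U.symm.toLinearEquiv.toLinearMap)

/-! ### Density of states -/

/-- `|Λ_L|⁻¹ ∑_{x ∈ Λ_L} ⟨δ_x, g(H_L) δ_x⟩`. -/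
noncomputable def boxAverage (H : EllTwo →ₗ.[ℂ] EllTwo) (L : ℕ) (g : ℝ → ℂ) : ℂ :=
  ((box L).card : ℂ)⁻¹ * ∑ x ∈ box L, ⟪deltaVec x, applyFun g (truncation H L) (deltaVec x)⟫_ℂ

/-- `k` is the Radon measure on `ℝ` corresponding to the linear functional `I` on `C_c(ℝ)`. -/
def IsRieszMeasure (I : (ℝ → ℂ) → ℂ) (k : Measure ℝ) : Prop :=
  k.Regular ∧ ∀ g : C_c(ℝ, ℂ), ∫ t, g t ∂k = I g

/-- `k` is the density of states measure of the truncated operator `H_L`. -/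
def IsFiniteVolumeDOSMeasure (H : EllTwo →ₗ.[ℂ] EllTwo) (L : ℕ) (k : Measure ℝ) : Prop :=
  IsRieszMeasure (boxAverage H L) k

/-- `k` is the density of states measure of the random operator `H`, i.e. the Radon measure with
`∫ g dk = 𝔼 ⟨δ₀, g(H(ω)) δ₀⟩`. -/
def IsDOSMeasure {Ω : Type*} [MeasurableSpace Ω] (P : Measure Ω)
    (H : Ω → (EllTwo →ₗ.[ℂ] EllTwo)) (k : Measure ℝ) : Prop :=
  IsRieszMeasure (fun g => ∫ ω, ⟪deltaVec 0, applyFun g (H ω) (deltaVec 0)⟫_ℂ ∂P) k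

/-! Write P for the projection onto the box, R and R_L for the resolvents at i of H and H_L, and T
for the trace-class extension of H_L - PH. Since P commutes with R_L, the second resolvent identity,
multiplied by P, becomes P(R_L - R) = -P R_L T R (`boxProjL_mul_resolvent_sub`). By the trace
inequality `IsTraceClass.norm_sum_inner_le`, its diagonal sum over the box is at most a constant
times tr|T| ≤ ε(L)|Λ_L|, also between bounded factors Y and Z.

The continuous f for which P(f(R_L) - f(R)) is negligible per unit volume therefore include w and
its conjugate. They are closed under sums and uniform limits, and under products because P commutes
with f(R_L). Stone–Weierstrass on the circle containing all the spectra gives every f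
(`traceNegligible_resolventCalculus_sub`). So H_L may be replaced by H in the box averages.

By covariance ⟨δ_x, g(H(ω)) δ_x⟩ is the value at T_{-x}ω of one integrable function, so Birkhoff's
theorem, applied to T_1 and T_{-1}, gives the limit. A countable dense family of g yields one null
set for all g (`IsErgodicOperator.ae_tendsto_average`).

The measures come from the Riesz–Markov theorem. They have mass one because δ_x lies in the domain,
which makes g(H)δ_x → δ_x as g increases to 1 quantitative. With no mass lost, vague convergence is
weak convergence. -/

/-! ### Averages over boxes -/

theorem sum_box (a : ℤ → ℂ) (L : ℕ) :
    ∑ x ∈ box L, a x =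
      ∑ k ∈ Finset.range (L + 1), a k + ∑ k ∈ Finset.range (L + 1), a (-k) - a 0 := by
  induction L with
  | zero => simp [box]
  | succ L ih =>
    have h : box (L + 1) = insert ((L : ℤ) + 1) (insert (-((L : ℤ) + 1)) (box L)) := by
      ext x
      simp only [box, Finset.mem_Icc, Finset.mem_insert]
      push_cast
      omega
    rw [h, Finset.sum_insert, Finset.sum_insert, ih, Finset.sum_range_succ _ (L + 1),
      Finset.sum_range_succ _ (L + 1)]
    · push_cast
      ring
    · simp only [box, Finset.mem_Icc]
      omega
    · simp only [box, Finset.mem_Icc, Finset.mem_insert]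
      omega

theorem card_box (L : ℕ) : (box L).card = 2 * L + 1 := by
  simp only [box, Int.card_Icc]
  omega

/-- The box is the union of two half-line windows of length L + 1 that share only 0. Each has weight
(L + 1)/(2L + 1) → 1/2, and the doubly counted term a 0 disappears in the limit. -/
theorem tendsto_box_average {a : ℤ → ℂ} {m : ℂ}
    (h1 : Tendsto (fun n : ℕ => (n : ℂ)⁻¹ * ∑ k ∈ Finset.range n, a k) atTop (𝓝 m))
    (h2 : Tendsto (fun n : ℕ => (n : ℂ)⁻¹ * ∑ k ∈ Finset.range n, a (-k)) atTop (𝓝 m)) :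
    Tendsto (fun L : ℕ => ((box L).card : ℂ)⁻¹ * ∑ x ∈ box L, a x) atTop (𝓝 m) := by
  have hi : Tendsto (fun L : ℕ => ((2 * L + 1 : ℕ) : ℂ)⁻¹) atTop (𝓝 0) := by
    refine (tendsto_inv_atTop_nhds_zero_nat (𝕜 := ℂ)).comp ?_
    exact tendsto_atTop_mono (fun n => show n ≤ 2 * n + 1 by omega) tendsto_id
  have h3 : Tendsto (fun L : ℕ => ((2 * L + 1 : ℕ) : ℂ)⁻¹ * ((L + 1 : ℕ) : ℂ)) atTop (𝓝 (1 / 2)) := by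
    have : Tendsto (fun L : ℕ => (1 / 2 : ℂ) + 1 / 2 * ((2 * L + 1 : ℕ) : ℂ)⁻¹) atTop
        (𝓝 (1 / 2 + 1 / 2 * 0)) := tendsto_const_nhds.add (hi.const_mul _)
    rw [mul_zero, add_zero] at this
    refine this.congr fun L => ?_
    have : ((2 * L + 1 : ℕ) : ℂ) ≠ 0 := by exact_mod_cast (2 * L).succ_ne_zero
    field_simp
    push_cast
    ring
  have h1' := (h1.comp (tendsto_add_atTop_nat 1))
  have h2' := (h2.comp (tendsto_add_atTop_nat 1))
  have := ((h3.mul h1').add (h3.mul h2')).sub (hi.mul_const (a 0))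
  rw [show (1 / 2 * m + 1 / 2 * m - 0 * a 0 : ℂ) = m by ring] at this
  refine this.congr fun L => ?_
  have h0 : ((L + 1 : ℕ) : ℂ) ≠ 0 := by exact_mod_cast L.succ_ne_zero
  rw [card_box, sum_box]
  simp only [Function.comp]
  field_simp

/-! ### The pointwise ergodic theorem -/

section Birkhoff

variable {Ω : Type*}

/-- The running maximum `max_{k ≤ n} ∑_{j < k} f (T^j ω)` of the Birkhoff sums. -/
noncomputable def birkhoffMax (T : Ω → Ω) (f : Ω → ℝ) : ℕ → Ω → ℝ
  | 0, _ => 0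
  | n + 1, ω => max 0 (f ω + birkhoffMax T f n (T ω))

theorem birkhoffMax_nonneg (T : Ω → Ω) (f : Ω → ℝ) (n : ℕ) (ω : Ω) : 0 ≤ birkhoffMax T f n ω := by
  cases n with
  | zero => exact le_rfl
  | succ n => exact le_max_left _ _

theorem birkhoffMax_mono (T : Ω → Ω) (f : Ω → ℝ) (ω : Ω) :
    Monotone fun n => birkhoffMax T f n ω := by
  refine monotone_nat_of_le_succ fun n => ?_
  induction n generalizing ω with
  | zero => exact birkhoffMax_nonneg T f 1 ω
  | succ n ih => exact max_le_max le_rfl (add_le_add le_rfl (ih (T ω)))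

theorem birkhoffSum_le_birkhoffMax (T : Ω → Ω) (f : Ω → ℝ) (n : ℕ) (ω : Ω) :
    birkhoffSum T f n ω ≤ birkhoffMax T f n ω := by
  induction n generalizing ω with
  | zero => simp [birkhoffMax]
  | succ n ih =>
    rw [birkhoffSum_succ']
    exact (add_le_add le_rfl (ih (T ω))).trans (le_max_right _ _)

/-- One step of the recursion changes the maxima by at most the finite number f ω. The set of
bounded orbits is thus strictly invariant, and ergodicity gives it measure zero or full measure. -/
theorem bddAbove_birkhoffMax_comp (T : Ω → Ω) (f : Ω → ℝ) (ω : Ω) :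
    BddAbove (Set.range fun n => birkhoffMax T f n (T ω)) ↔
      BddAbove (Set.range fun n => birkhoffMax T f n ω) := by
  constructor
  · rintro ⟨C, hC⟩
    refine ⟨max 0 (f ω + C), ?_⟩
    rintro _ ⟨n, rfl⟩
    cases n with
    | zero => exact le_max_left _ _
    | succ n => exact max_le_max le_rfl (add_le_add le_rfl (hC ⟨n, rfl⟩))
  · rintro ⟨C, hC⟩
    refine ⟨C - f ω, ?_⟩
    rintro _ ⟨n, rfl⟩
    have h1 : birkhoffMax T f (n + 1) ω ≤ C := hC ⟨n + 1, rfl⟩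
    have h2 : f ω + birkhoffMax T f n (T ω) ≤ birkhoffMax T f (n + 1) ω := le_max_right _ _
    simp only
    linarith

variable [MeasurableSpace Ω] {P : Measure Ω}

theorem measurable_birkhoffMax {T : Ω → Ω} {f : Ω → ℝ} (hT : Measurable T) (hf : Measurable f)
    (n : ℕ) : Measurable (birkhoffMax T f n) := by
  induction n with
  | zero => exact measurable_const
  | succ n ih => exact measurable_const.max (hf.add (ih.comp hT))

theorem integrable_birkhoffMax {T : Ω → Ω} {f : Ω → ℝ} (hT : MeasurePreserving T P P)
    (hf : Integrable f P) (n : ℕ) : Integrable (birkhoffMax T f n) P := by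
  induction n with
  | zero => exact integrable_zero _ _ _
  | succ n ih =>
    exact (integrable_zero _ _ _).sup (hf.add (hT.integrable_comp_of_integrable ih))

/-- If `f` has negative mean, then its Birkhoff sums are almost surely bounded above. -/
theorem Ergodic.ae_bddAbove_birkhoffMax {T : Ω → Ω} {f : Ω → ℝ} (hT : Ergodic T P)
    (hfm : Measurable f) (hf : Integrable f P) (hneg : ∫ ω, f ω ∂P < 0) :
    ∀ᵐ ω ∂P, BddAbove (Set.range fun n => birkhoffMax T f n ω) := by
  have hTm := hT.toMeasurePreserving
  have hA : MeasurableSet {ω | BddAbove (Set.range fun n => birkhoffMax T f n ω)} :=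
    measurableSet_bddAbove_range fun n => measurable_birkhoffMax hTm.measurable hfm n
  have hinv : T ⁻¹' {ω | BddAbove (Set.range fun n => birkhoffMax T f n ω)} =
      {ω | BddAbove (Set.range fun n => birkhoffMax T f n ω)} := by
    ext ω
    exact bddAbove_birkhoffMax_comp T f ω
  rcases hT.toPreErgodic.ae_mem_or_ae_notMem hA hinv with h | h
  · exact h
  · exfalso
    -- If the maxima M_n diverged almost surely, g_n = max(-M_n ∘ T, f) would converge to f,
    -- dominated by |f|. But ∫ g_n = ∫ M_{n+1} - ∫ M_n ≥ 0 by invariance of P and monotonicity,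
    -- which contradicts ∫ f < 0.
    let g : ℕ → Ω → ℝ := fun n ω => birkhoffMax T f (n + 1) ω - birkhoffMax T f n (T ω)
    have hint : ∀ n, Integrable (fun ω => birkhoffMax T f n (T ω)) P := fun n =>
      hTm.integrable_comp_of_integrable (integrable_birkhoffMax hTm hf n)
    have hg : ∀ n ω, g n ω = max (-birkhoffMax T f n (T ω)) (f ω) := by
      intro n ω
      simp only [g, birkhoffMax]
      rw [← max_sub_sub_right]
      simp
    have hpos : ∀ n, 0 ≤ ∫ ω, g n ω ∂P := by
      intro n
      have h1 : ∫ ω, birkhoffMax T f n (T ω) ∂P = ∫ ω, birkhoffMax T f n ω ∂P := by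
        have := integral_map (μ := P) hTm.measurable.aemeasurable
          (f := birkhoffMax T f n) (measurable_birkhoffMax hTm.measurable hfm n).aestronglyMeasurable
        rw [hTm.map_eq] at this
        exact this.symm
      simp only [g]
      rw [integral_sub (integrable_birkhoffMax hTm hf _) (hint n), h1, sub_nonneg]
      exact integral_mono (integrable_birkhoffMax hTm hf _) (integrable_birkhoffMax hTm hf _)
        fun ω => birkhoffMax_mono T f ω n.le_succ
    have hlim : Tendsto (fun n => ∫ ω, g n ω ∂P) atTop (𝓝 (∫ ω, f ω ∂P)) := by
      refine tendsto_integral_of_dominated_convergence (fun ω => |f ω|)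
        (fun n => ((integrable_birkhoffMax hTm hf _).sub (hint n)).aestronglyMeasurable) hf.abs
        (fun n => Eventually.of_forall fun ω => ?_) ?_
      · rw [hg, Real.norm_eq_abs]
        have := birkhoffMax_nonneg T f n (T ω)
        refine abs_le.2 ⟨(neg_abs_le _).trans (le_max_right _ _), max_le ?_ (le_abs_self _)⟩
        linarith [abs_nonneg (f ω)]
      · filter_upwards [h] with ω hω
        have hω' : ¬ BddAbove (Set.range fun n => birkhoffMax T f n (T ω)) := fun h' =>
          hω ((bddAbove_birkhoffMax_comp T f ω).1 h')
        have ht := tendsto_atTop_atTop_of_monotone' (birkhoffMax_mono T f (T ω)) hω'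
        refine tendsto_const_nhds.congr' ?_
        filter_upwards [ht.eventually_ge_atTop (-f ω)] with n hn
        rw [hg, max_eq_right]
        linarith
    exact absurd (ge_of_tendsto' hlim hpos) (not_le.2 hneg)

/-- The function f - (m + δ/2) has mean -δ/2 < 0, so its Birkhoff sums are bounded by some C(ω); the
other half of δ absorbs C(ω) once n is large. -/
theorem Ergodic.ae_eventually_birkhoffSum_le [IsProbabilityMeasure P] {T : Ω → Ω} {f : Ω → ℝ}
    (hT : Ergodic T P) (hfm : Measurable f) (hf : Integrable f P) {δ : ℝ} (hδ : 0 < δ) :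
    ∀ᵐ ω ∂P, ∀ᶠ n : ℕ in atTop, birkhoffSum T f n ω ≤ n * (∫ ω, f ω ∂P + δ) := by
  set m := ∫ ω, f ω ∂P with hm
  have hc : Integrable (fun _ : Ω => m + δ / 2) P := integrable_const _
  have h := Ergodic.ae_bddAbove_birkhoffMax (f := fun ω => f ω - (m + δ / 2)) hT
    (hfm.sub_const _) (hf.sub hc) (by
      rw [integral_sub hf hc, ← hm]
      simp
      linarith)
  filter_upwards [h] with ω ⟨C, hC⟩
  obtain ⟨N, hN⟩ := exists_nat_ge (C / (δ / 2))
  filter_upwards [eventually_ge_atTop N] with n hn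
  have h1 := (birkhoffSum_le_birkhoffMax T (fun ω => f ω - (m + δ / 2)) n ω).trans (hC ⟨n, rfl⟩)
  have h2 : birkhoffSum T (fun ω => f ω - (m + δ / 2)) n ω =
      birkhoffSum T f n ω - n * (m + δ / 2) := by
    simp [birkhoffSum, Finset.sum_sub_distrib]
    ring
  have h3 : C ≤ n * (δ / 2) := by
    rw [div_le_iff₀ (by positivity)] at hN
    exact hN.trans (by gcongr)
  rw [h2] at h1
  nlinarith

/-- **Birkhoff's pointwise ergodic theorem** for an ergodic transformation. -/
theorem Ergodic.ae_tendsto_birkhoffAverage_real [IsProbabilityMeasure P] {T : Ω → Ω} {f : Ω → ℝ}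
    (hT : Ergodic T P) (hf : Integrable f P) :
    ∀ᵐ ω ∂P, Tendsto (fun n => birkhoffAverage ℝ T f n ω) atTop (𝓝 (∫ ω, f ω ∂P)) := by
  -- A measurable representative agrees with f along the entire orbit of almost every point, because
  -- the iterates preserve null sets.
  wlog hfm : Measurable f generalizing f
  · have hmk := hf.1.stronglyMeasurable_mk.measurable
    have h1 := this (hf.congr hf.1.ae_eq_mk) hmk
    have h2 : ∀ᵐ ω ∂P, ∀ k : ℕ, f (T^[k] ω) = hf.1.mk f (T^[k] ω) :=
      ae_all_iff.2 fun k => (hT.toMeasurePreserving.iterate k).quasiMeasurePreserving.ae hf.1.ae_eq_mk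
    filter_upwards [h1, h2] with ω h1 h2
    rw [integral_congr_ae hf.1.ae_eq_mk]
    refine h1.congr fun n => ?_
    simp [birkhoffAverage, birkhoffSum, h2]
  set m := ∫ ω, f ω ∂P with hm
  have hup : ∀ᵐ ω ∂P, ∀ k : ℕ, ∀ᶠ n : ℕ in atTop,
      birkhoffSum T f n ω ≤ n * (m + 1 / ((k : ℝ) + 1)) :=
    ae_all_iff.2 fun k => hT.ae_eventually_birkhoffSum_le hfm hf Nat.one_div_pos_of_nat
  have hlo : ∀ᵐ ω ∂P, ∀ k : ℕ, ∀ᶠ n : ℕ in atTop,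
      birkhoffSum T (fun ω => -f ω) n ω ≤ n * (-m + 1 / ((k : ℝ) + 1)) := by
    refine ae_all_iff.2 fun k => ?_
    have := hT.ae_eventually_birkhoffSum_le hfm.neg hf.neg (Nat.one_div_pos_of_nat (n := k) (α := ℝ))
    rw [show ∫ ω, (-f) ω ∂P = -m from integral_neg _] at this
    exact this
  filter_upwards [hup, hlo] with ω hup hlo
  rw [Metric.tendsto_atTop']
  intro η hη
  obtain ⟨k, hk⟩ := exists_nat_one_div_lt hη
  obtain ⟨N, hN⟩ := eventually_atTop.1 ((hup k).and (hlo k))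
  refine ⟨N, fun n hn => ?_⟩
  have hn0 : (0 : ℝ) < n := by exact_mod_cast (Nat.zero_le N).trans_lt hn
  obtain ⟨h1, h2⟩ := hN n hn.le
  have h3 : birkhoffSum T (fun ω => -f ω) n ω = -birkhoffSum T f n ω := by
    simp [birkhoffSum]
  rw [h3] at h2
  have h4 : birkhoffAverage ℝ T f n ω * n = birkhoffSum T f n ω := by
    rw [birkhoffAverage, smul_eq_mul]
    field_simp
  rw [← h4] at h1 h2
  rw [Real.dist_eq, abs_lt]
  constructor
  · have : -birkhoffAverage ℝ T f n ω ≤ -m + 1 / ((k : ℝ) + 1) :=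
      le_of_mul_le_mul_right (by linarith) hn0
    linarith
  · have : birkhoffAverage ℝ T f n ω ≤ m + 1 / ((k : ℝ) + 1) :=
      le_of_mul_le_mul_right (by linarith) hn0
    linarith

theorem Ergodic.ae_tendsto_birkhoffAverage_complex [IsProbabilityMeasure P] {T : Ω → Ω}
    {f : Ω → ℂ} (hT : Ergodic T P) (hf : Integrable f P) :
    ∀ᵐ ω ∂P, Tendsto (fun n : ℕ => (n : ℂ)⁻¹ * ∑ k ∈ Finset.range n, f (T^[k] ω)) atTop
      (𝓝 (∫ ω, f ω ∂P)) := by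
  filter_upwards [hT.ae_tendsto_birkhoffAverage_real hf.re,
    hT.ae_tendsto_birkhoffAverage_real hf.im] with ω h1 h2
  have h3 := ((Complex.continuous_ofReal.tendsto _).comp h1).add
    (((Complex.continuous_ofReal.tendsto _).comp h2).mul_const Complex.I)
  have h4 := integral_re_add_im hf
  simp only [RCLike.re_eq_complex_re, RCLike.im_eq_complex_im, RCLike.I_to_complex] at h3 h4
  have h5 : (((∫ ω, (f ω).re ∂P : ℝ) : ℂ) + ((∫ ω, (f ω).im ∂P : ℝ) : ℂ) * Complex.I) =
    ∫ ω, f ω ∂P := h4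
  rw [h5] at h3
  refine h3.congr fun n => ?_
  simp only [Function.comp, birkhoffAverage, birkhoffSum, smul_eq_mul]
  push_cast
  rw [mul_assoc, ← mul_add, Finset.sum_mul, ← Finset.sum_add_distrib]
  simp [Complex.re_add_im]

theorem IsErgodicShiftGroup.iterate {T : ℤ → Ω → Ω} (hT : IsErgodicShiftGroup P T) (x : ℤ) (k : ℕ)
    (ω : Ω) : (T x)^[k] ω = T (k * x) ω := by
  induction k generalizing ω with
  | zero => simp [hT.map_zero]
  | succ k ih =>
    rw [Function.iterate_succ_apply, ih, ← hT.map_add]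
    congr 1
    push_cast
    ring

/-- Since u = ±1 generates ℤ, a set invariant under T_u alone is invariant under the whole group.
Both signs are needed, one for each half-line. -/
theorem IsErgodicShiftGroup.ergodic_of_isUnit [IsProbabilityMeasure P] {T : ℤ → Ω → Ω}
    (hT : IsErgodicShiftGroup P T) {u : ℤ} (hu : IsUnit u) : Ergodic (T u) P := by
  refine { hT.measurePreserving u with aeconst_set := fun {A} hA hinv => ?_ }
  have hneg : T (-u) ⁻¹' A = A := by
    conv_lhs => rw [← hinv]
    ext ω
    simp [← hT.map_add, hT.map_zero]
  have hk : ∀ v : ℤ, T v ⁻¹' A = A → ∀ k : ℕ, T (k * v) ⁻¹' A = A := by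
    intro v hv k
    have : T (k * v) = (T v)^[k] := funext fun ω => (hT.iterate v k ω).symm
    rw [this]
    induction k with
    | zero => rfl
    | succ k ih =>
      rw [Function.iterate_succ, Set.preimage_comp, ih (funext fun ω => (hT.iterate v k ω).symm), hv]
  have hall : ∀ x, T x ⁻¹' A = A := by
    intro x
    have hux : x = u * x * u := by
      rcases Int.isUnit_iff.1 hu with rfl | rfl <;> ring
    rcases Int.eq_nat_or_neg (u * x) with ⟨n, hn | hn⟩
    · rw [hux, hn]
      exact hk u hinv n
    · rw [hux, hn, neg_mul_comm]
      exact hk (-u) hneg n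
  rw [eventuallyConst_set']
  rcases hT.ergodic A hA hall with h | h
  · exact Or.inl (ae_eq_empty.2 h)
  · right
    rw [ae_eq_univ]
    exact (prob_compl_eq_zero_iff hA).2 h

/-- The ergodic theorem for averages over the boxes `Λ_L`. -/
theorem IsErgodicShiftGroup.ae_tendsto_box_average [IsProbabilityMeasure P] {T : ℤ → Ω → Ω}
    (hT : IsErgodicShiftGroup P T) {f : Ω → ℂ} (hf : Integrable f P) :
    ∀ᵐ ω ∂P, Tendsto (fun L : ℕ => ((box L).card : ℂ)⁻¹ * ∑ x ∈ box L, f (T (-x) ω)) atTop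
      (𝓝 (∫ ω, f ω ∂P)) := by
  filter_upwards [(hT.ergodic_of_isUnit isUnit_one).ae_tendsto_birkhoffAverage_complex hf,
    (hT.ergodic_of_isUnit isUnit_one.neg).ae_tendsto_birkhoffAverage_complex hf] with ω h1 h2
  simp only [hT.iterate] at h1 h2
  -- The summand at x is evaluated at T_{-x}, so the sites x ≥ 0 use T_{-1} and the sites x ≤ 0 use
  -- T_1.
  exact tendsto_box_average (by simpa using h2) (by simpa using h1)

end Birkhoff

/-! ### Functional calculus through the resolvent at i -/

section ResolventCalculus

open scoped ComplexOrder

variable {E : Type*} [NormedAddCommGroup E] [InnerProductSpace ℂ E]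

/-- The circle `{(t - i)⁻¹ | t ∈ ℝ} ∪ {0}`. -/
def resolventCircle : Set ℂ := {w | Complex.normSq w = w.im}

theorem norm_le_one_of_mem_resolventCircle {w : ℂ} (hw : w ∈ resolventCircle) : ‖w‖ ≤ 1 := by
  have h1 : ‖w‖ ^ 2 = w.im := by rw [← Complex.normSq_eq_norm_sq]; exact hw
  have h2 : w.im ≤ ‖w‖ := (le_abs_self _).trans (Complex.abs_im_le_norm w)
  nlinarith [norm_nonneg w]

theorem isCompact_resolventCircle : IsCompact resolventCircle := by
  refine Metric.isCompact_of_isClosed_isBounded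
    (isClosed_eq Complex.continuous_normSq Complex.continuous_im) ?_
  refine (Metric.isBounded_closedBall (x := (0 : ℂ)) (r := 1)).subset fun w hw => ?_
  simpa using norm_le_one_of_mem_resolventCircle hw

instance : CompactSpace resolventCircle := isCompact_iff_compactSpace.1 isCompact_resolventCircle

theorem inv_im_of_mem_resolventCircle {w : ℂ} (hw : w ∈ resolventCircle) (h0 : w ≠ 0) :
    (w⁻¹).im = -1 := by
  rw [Complex.inv_im, ← show Complex.normSq w = w.im from hw, neg_div, div_self]
  simpa using h0

/-- Only w = 0 is delicate. On the circle Im(1/w) = -1, hence |Re(1/w)| ≥ 1/|w| - 1 → ∞ as w → 0,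
and g vanishes at infinity. -/
theorem continuous_circleLift (g : C₀(ℝ, ℂ)) :
    Continuous fun w : resolventCircle => if (w : ℂ) = 0 then 0 else g ((w : ℂ)⁻¹).re := by
  have hg : Continuous g := g.continuous
  rw [continuous_iff_continuousAt]
  intro w
  by_cases hw : (w : ℂ) = 0
  · rw [continuousAt_iff_punctured_nhds]
    simp only [hw, if_true]
    have h1 : Tendsto (fun v : resolventCircle => (v : ℂ)) (𝓝[≠] w) (𝓝[≠] 0) := by
      refine tendsto_nhdsWithin_iff.2 ⟨?_, ?_⟩
      · rw [← hw]
        exact (continuous_subtype_val.tendsto w).mono_left nhdsWithin_le_nhds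
      · filter_upwards [self_mem_nhdsWithin] with v hv h
        exact hv (Subtype.ext (h.trans hw.symm))
    have h2 : Tendsto (fun v : resolventCircle => ((v : ℂ)⁻¹).re) (𝓝[≠] w) (cocompact ℝ) := by
      rw [← Metric.cobounded_eq_cocompact, ← tendsto_norm_atTop_iff_cobounded]
      have h3 := (tendsto_norm_cobounded_atTop.comp (tendsto_inv₀_nhdsNE_zero.comp h1))
      refine tendsto_atTop_mono' _ ?_ (tendsto_atTop_add_const_right _ (-1) h3)
      filter_upwards [h1 self_mem_nhdsWithin] with v hv
      have h4 := Complex.norm_le_abs_re_add_abs_im ((v : ℂ)⁻¹)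
      rw [inv_im_of_mem_resolventCircle v.2 hv] at h4
      simp only [Function.comp, Real.norm_eq_abs]
      norm_num at h4 ⊢
      linarith
    refine (g.zero_at_infty'.comp h2).congr' ?_
    filter_upwards [h1 self_mem_nhdsWithin] with v hv
    rw [if_neg (show (v : ℂ) ≠ 0 from hv)]
    rfl
  · have h1 : ∀ᶠ v : resolventCircle in 𝓝 w, (v : ℂ) ≠ 0 :=
      (continuous_subtype_val.tendsto w).eventually_ne hw
    have h2 : ContinuousAt (fun v : resolventCircle => g ((v : ℂ)⁻¹).re) w :=
      hg.continuousAt.comp (Complex.continuous_re.continuousAt.comp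
        (continuous_subtype_val.continuousAt.inv₀ hw))
    refine h2.congr ?_
    filter_upwards [h1] with v hv
    rw [if_neg hv]

/-- The function `w ↦ g (Re (1 / w))`, extended by `0` to `w = 0`, on the circle that contains
the spectra of the resolvents `(A - i)⁻¹`. -/
noncomputable def circleLift (g : C₀(ℝ, ℂ)) : C(resolventCircle, ℂ) :=
  ⟨fun w => if (w : ℂ) = 0 then 0 else g ((w : ℂ)⁻¹).re, continuous_circleLift g⟩

theorem circleLift_apply (g : C₀(ℝ, ℂ)) (w : resolventCircle) :
    circleLift g w = if (w : ℂ) = 0 then 0 else g ((w : ℂ)⁻¹).re := rfl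

/-- The inclusion of the circle into the plane. -/
noncomputable def circleCoord : C(resolventCircle, ℂ) := .restrict resolventCircle (.id ℂ)

/-- The first resolvent identity. Used at z, z' = ±i, it yields both normality of the resolvent and
the location of its spectrum. -/
theorem IsResolventAt.sub_eq {A : E →ₗ.[ℂ] E} {z z' : ℂ} {R R' : E →L[ℂ] E}
    (h : IsResolventAt A z R) (h' : IsResolventAt A z' R') : R - R' = (z - z') • (R' * R) := by
  ext ψ
  obtain ⟨hd, he⟩ := h.1 ψ
  have h1 := h'.2 ⟨R ψ, hd⟩
  simp only at h1
  have h2 : A ⟨R ψ, hd⟩ - z' • R ψ = ψ + (z - z') • R ψ := by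
    rw [sub_smul, sub_eq_iff_eq_add.1 he]
    abel
  rw [h2, map_add, map_smul] at h1
  simp only [sub_apply, smul_apply,
    mul_apply_eq_comp]
  exact (eq_sub_of_add_eq' h1).symm

variable [CompleteSpace E]

theorem IsSelfAdjoint.inner_apply_eq {A : E →ₗ.[ℂ] E} (hA : IsSelfAdjoint A) (x y : A.domain) :
    ⟪A x, (y : E)⟫_ℂ = ⟪(x : E), A y⟫_ℂ := by
  have := LinearPMap.adjoint_isFormalAdjoint hA.dense_domain
  rw [show A.adjoint = A from hA] at this
  exact this x y

theorem IsSelfAdjoint.mem_domain_of_inner_eq {A : E →ₗ.[ℂ] E} (hA : IsSelfAdjoint A) {y v : E}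
    (h : ∀ x : A.domain, ⟪v, (x : E)⟫_ℂ = ⟪y, A x⟫_ℂ) : ∃ h : y ∈ A.domain, A ⟨y, h⟩ = v := by
  have hd := hA.dense_domain
  -- The value of B carries a proof of membership in its domain, so the adjoint is replaced by A by
  -- substituting a variable operator.
  have key : ∀ B : E →ₗ.[ℂ] E, B = A → ∀ h : y ∈ B.domain, B ⟨y, h⟩ = v →
      ∃ h : y ∈ A.domain, A ⟨y, h⟩ = v := by
    rintro B rfl h h'
    exact ⟨h, h'⟩
  exact key _ hA (LinearPMap.mem_adjoint_domain_of_exists y ⟨_, h⟩)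
    (LinearPMap.adjoint_apply_eq hd _ h)

theorem IsResolventAt.star {A : E →ₗ.[ℂ] E} (hA : IsSelfAdjoint A) {z : ℂ} {R : E →L[ℂ] E}
    (h : IsResolventAt A z R) : IsResolventAt A (starRingEnd ℂ z) (star R) := by
  constructor
  · intro ψ
    have h1 : ∀ x : A.domain,
        ⟪ψ + starRingEnd ℂ z • Star.star R ψ, (x : E)⟫_ℂ = ⟪Star.star R ψ, A x⟫_ℂ := by
      intro x
      have h2 := h.2 x
      have h3 : ⟪Star.star R ψ, A x - z • (x : E)⟫_ℂ = ⟪ψ, (x : E)⟫_ℂ := by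
        rw [ContinuousLinearMap.star_eq_adjoint, ContinuousLinearMap.adjoint_inner_left, h2]
      rw [inner_sub_right, inner_smul_right] at h3
      rw [inner_add_left, inner_smul_left, ← h3, Complex.conj_conj]
      ring
    obtain ⟨hd, he⟩ := hA.mem_domain_of_inner_eq h1
    exact ⟨hd, by rw [he]; abel⟩
  · intro x
    refine ext_inner_right ℂ fun y => ?_
    obtain ⟨hd, he⟩ := h.1 y
    rw [ContinuousLinearMap.star_eq_adjoint, ContinuousLinearMap.adjoint_inner_left,
      inner_sub_left, inner_smul_left, Complex.conj_conj]
    have := hA.inner_apply_eq x ⟨R y, hd⟩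
    rw [this]
    conv_rhs => rw [← he]
    rw [inner_sub_right, inner_smul_right]

theorem star_isResolventAt {A : E →ₗ.[ℂ] E} (hA : IsSelfAdjoint A) :
    IsResolventAt A (-Complex.I) (star (resolventAt A Complex.I)) := by
  have := (isResolventAt_resolventAt_I hA).star hA
  rwa [Complex.conj_I] at this

/-- The resolvent identity in its two orders expresses R - R† as 2i R†R and as 2i RR†. -/
theorem isStarNormal_resolventAt {A : E →ₗ.[ℂ] E} (hA : IsSelfAdjoint A) :
    IsStarNormal (resolventAt A Complex.I) := by
  have h1 := (isResolventAt_resolventAt_I hA).sub_eq (star_isResolventAt hA)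
  have h2 := (star_isResolventAt hA).sub_eq (isResolventAt_resolventAt_I hA)
  rw [← neg_sub, h1, ← neg_smul] at h2
  have h3 : -(Complex.I - -Complex.I) = -Complex.I - Complex.I := by ring
  have h4 : (-Complex.I - Complex.I) ≠ 0 := by
    intro h
    have := congrArg Complex.im h
    norm_num at this
  rw [h3] at h2
  exact ⟨smul_right_injective _ h4 h2⟩

/-- The relation R - R† = 2i R†R passes through the injective functional calculus to w - w̄ = 2i|w|²
on the spectrum, that is Im w = |w|². -/
theorem spectrum_resolventAt_subset {A : E →ₗ.[ℂ] E} (hA : IsSelfAdjoint A) :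
    spectrum ℂ (resolventAt A Complex.I) ⊆ resolventCircle := by
  have hn := isStarNormal_resolventAt hA
  intro w hw
  set R := resolventAt A Complex.I
  let X : C(spectrum ℂ R, ℂ) := .restrict (spectrum ℂ R) (.id ℂ)
  have h1 : R - star R = (Complex.I - -Complex.I) • (star R * R) :=
    (isResolventAt_resolventAt_I hA).sub_eq (star_isResolventAt hA)
  have hX : cfcHom hn X = R := cfcHom_id hn
  have h2 : cfcHom hn (X - star X - (Complex.I - -Complex.I) • (star X * X)) = 0 := by
    simp only [map_sub, map_smul, map_mul, map_star, hX]
    rw [h1, sub_self]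
  have h3 := (map_eq_zero_iff _ (cfcHom_injective hn)).1 h2
  have h4 : w - starRingEnd ℂ w - (Complex.I - -Complex.I) * (starRingEnd ℂ w * w) = 0 :=
    DFunLike.congr_fun h3 ⟨w, hw⟩
  have h5 := congrArg Complex.im h4
  rw [← Complex.normSq_eq_conj_mul_self] at h5
  simp at h5
  change Complex.normSq w = w.im
  linarith

/-- The functional calculus `h ↦ h((A - i)⁻¹)` of a self-adjoint operator `A`. -/
noncomputable def resolventCalculus {A : E →ₗ.[ℂ] E} (hA : IsSelfAdjoint A) :
    C(resolventCircle, ℂ) →⋆ₐ[ℂ] (E →L[ℂ] E) :=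
  (cfcHom (isStarNormal_resolventAt hA)).comp
    (ContinuousMap.compStarAlgHom' ℂ ℂ
      ⟨Set.inclusion (spectrum_resolventAt_subset hA), continuous_inclusion _⟩)

theorem resolventCalculus_circleCoord {A : E →ₗ.[ℂ] E} (hA : IsSelfAdjoint A) :
    resolventCalculus hA circleCoord = resolventAt A Complex.I :=
  cfcHom_id (isStarNormal_resolventAt hA)

theorem norm_resolventCalculus_le {A : E →ₗ.[ℂ] E} (hA : IsSelfAdjoint A)
    (h : C(resolventCircle, ℂ)) : ‖resolventCalculus hA h‖ ≤ ‖h‖ :=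
  NonUnitalStarAlgHom.norm_apply_le _ h

theorem continuous_resolventCalculus {A : E →ₗ.[ℂ] E} (hA : IsSelfAdjoint A) :
    Continuous fun h : C(resolventCircle, ℂ) => resolventCalculus hA h :=
  AddMonoidHomClass.continuous_of_bound (resolventCalculus hA) 1 fun h =>
    (norm_resolventCalculus_le hA h).trans (one_mul _).ge

theorem applyFun_eq_resolventCalculus {A : E →ₗ.[ℂ] E} (hA : IsSelfAdjoint A) (g : C₀(ℝ, ℂ)) :
    applyFun g A = resolventCalculus hA (circleLift g) := by
  have hc : ContinuousOn (fun w : ℂ => if w = 0 then 0 else g (w⁻¹).re)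
      (spectrum ℂ (resolventAt A Complex.I)) :=
    (continuousOn_iff_continuous_domRestrict.2 (continuous_circleLift g)).mono
      (spectrum_resolventAt_subset hA)
  rw [applyFun, cfc_apply _ _ (isStarNormal_resolventAt hA) hc]
  rfl

theorem norm_circleLift_le {g : C₀(ℝ, ℂ)} {C : ℝ} (hC : 0 ≤ C) (hg : ∀ t, ‖g t‖ ≤ C) :
    ‖circleLift g‖ ≤ C := by
  refine (ContinuousMap.norm_le _ hC).2 fun w => ?_
  rw [circleLift_apply]
  split_ifs
  · simpa using hC
  · exact hg _

/-- A quantitative form of `g(A) → 1` as `g ↑ 1`. -/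
theorem norm_inner_applyFun_sub_le {A : E →ₗ.[ℂ] E} (hA : IsSelfAdjoint A) {g : C₀(ℝ, ℂ)} {r : ℝ}
    (hr : 0 < r) (hg1 : ∀ t, |t| ≤ r → g t = 1) (hg : ∀ t, ‖1 - g t‖ ≤ 1) (ψ : A.domain) :
    ‖⟪(ψ : E), ψ⟫_ℂ - ⟪(ψ : E), applyFun g A ψ⟫_ℂ‖ ≤
      ‖(ψ : E)‖ * (r⁻¹ * ‖A ψ - Complex.I • (ψ : E)‖) := by
  -- Since ψ = R(A - i)ψ, the factor w of R can be joined to 1 - g. Where g ≠ 1 and w ≠ 0, |Re(1/w)|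
  -- > r, so the product is at most 1/r.
  have h1 : (ψ : E) - applyFun g A ψ =
      resolventCalculus hA ((1 - circleLift g) * circleCoord) (A ψ - Complex.I • (ψ : E)) := by
    rw [map_mul, resolventCalculus_circleCoord, mul_apply_eq_comp,
      (isResolventAt_resolventAt_I hA).2, applyFun_eq_resolventCalculus hA, map_sub, map_one]
    rfl
  have h2 : ‖(1 - circleLift g) * circleCoord‖ ≤ r⁻¹ := by
    refine (ContinuousMap.norm_le _ (by positivity)).2 fun w => ?_
    have hw : ((1 - circleLift g) * circleCoord) w = (1 - circleLift g w) * (w : ℂ) := rfl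
    rw [hw, circleLift_apply]
    split_ifs with h0
    · simp [h0, hr.le]
    · by_cases hle : |((w : ℂ)⁻¹).re| ≤ r
      · rw [hg1 _ hle, sub_self, zero_mul, norm_zero]
        positivity
      · have h3 : r ≤ ‖(w : ℂ)‖⁻¹ := by
          rw [← norm_inv]
          exact (not_le.1 hle).le.trans (Complex.abs_re_le_norm _)
        have h4 : ‖(w : ℂ)‖ ≤ r⁻¹ := by
          rw [← inv_inv ‖(w : ℂ)‖]
          exact inv_anti₀ hr h3
        rw [norm_mul]
        exact (mul_le_mul (hg _) h4 (norm_nonneg _) zero_le_one).trans (one_mul _).le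
  rw [← inner_sub_right, h1]
  refine (norm_inner_le_norm _ _).trans (mul_le_mul_of_nonneg_left ?_ (norm_nonneg _))
  refine (ContinuousLinearMap.le_opNorm _ _).trans (mul_le_mul_of_nonneg_right ?_ (norm_nonneg _))
  exact (norm_resolventCalculus_le hA _).trans h2

theorem inner_resolventCalculus_nonneg {A : E →ₗ.[ℂ] E} (hA : IsSelfAdjoint A)
    (h : C(resolventCircle, ℂ)) (ψ : E) :
    0 ≤ ⟪ψ, resolventCalculus hA (star h * h) ψ⟫_ℂ := by
  rw [map_mul, map_star, mul_apply_eq_comp, ContinuousLinearMap.star_eq_adjoint,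
    ContinuousLinearMap.adjoint_inner_right]
  rw [inner_self_eq_norm_sq_to_K]
  norm_cast
  positivity

/-- With s the square root of the lifted g, the matrix element is ‖s(R)ψ‖². -/
theorem inner_applyFun_nonneg {A : E →ₗ.[ℂ] E} (hA : IsSelfAdjoint A) {g : C₀(ℝ, ℂ)}
    (hg : ∀ t, 0 ≤ g t) (ψ : E) : 0 ≤ ⟪ψ, applyFun g A ψ⟫_ℂ := by
  let s : C(resolventCircle, ℂ) :=
    ⟨fun w => ((Real.sqrt (circleLift g w).re : ℝ) : ℂ),
      Complex.continuous_ofReal.comp (Real.continuous_sqrt.comp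
        (Complex.continuous_re.comp (circleLift g).continuous))⟩
  have hs : circleLift g = star s * s := by
    ext w
    have h0 : 0 ≤ circleLift g w := by
      rw [circleLift_apply]
      split_ifs
      exacts [le_rfl, hg _]
    have hw : (star s * s) w = starRingEnd ℂ (Real.sqrt (circleLift g w).re : ℝ) *
      (Real.sqrt (circleLift g w).re : ℝ) := rfl
    rw [hw, Complex.conj_ofReal, ← Complex.ofReal_mul,
      Real.mul_self_sqrt (Complex.le_def.1 h0).1]
    exact Complex.ext rfl (by simpa using (Complex.le_def.1 h0).2.symm)
  rw [applyFun_eq_resolventCalculus hA, hs]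
  exact inner_resolventCalculus_nonneg hA s ψ

theorem IsResolventAt.conj {A : E →ₗ.[ℂ] E} {z : ℂ} {R : E →L[ℂ] E} (h : IsResolventAt A z R)
    (U : E ≃ₗᵢ[ℂ] E) :
    IsResolventAt
      (U.toLinearEquiv.toLinearMap.compPMap (A.compLin U.symm.toLinearEquiv.toLinearMap)) z
      (U.conjStarAlgEquiv R) := by
  constructor
  · intro ψ
    obtain ⟨hd, he⟩ := h.1 (U.symm ψ)
    have hd' : U.symm (U (R (U.symm ψ))) ∈ A.domain := by rwa [U.symm_apply_apply]
    refine ⟨hd', ?_⟩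
    change U (A ⟨U.symm (U (R (U.symm ψ))), hd'⟩) - z • U (R (U.symm ψ)) = ψ
    have h1 : (⟨U.symm (U (R (U.symm ψ))), hd'⟩ : A.domain) = ⟨R (U.symm ψ), hd⟩ :=
      Subtype.ext (U.symm_apply_apply _)
    rw [h1, ← map_smul, ← map_sub, he, U.apply_symm_apply]
  · rintro ⟨ψ, hψ⟩
    have hψ' : U.symm ψ ∈ A.domain := hψ
    have := h.2 ⟨U.symm ψ, hψ'⟩
    change U (R (U.symm (U (A ⟨U.symm ψ, hψ'⟩) - z • ψ))) = ψ
    rw [map_sub, map_smul, U.symm_apply_apply, this]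
    exact U.apply_symm_apply ψ

/-- Both sides are continuous star homomorphisms in f. They agree on the coordinate w by uniqueness
of the resolvent, hence everywhere by Stone–Weierstrass. -/
theorem resolventCalculus_conj {A A' : E →ₗ.[ℂ] E} (hA : IsSelfAdjoint A) (hA' : IsSelfAdjoint A')
    (U : E ≃ₗᵢ[ℂ] E)
    (h : A' = U.toLinearEquiv.toLinearMap.compPMap
      (A.compLin U.symm.toLinearEquiv.toLinearMap)) (f : C(resolventCircle, ℂ)) :
    resolventCalculus hA' f = U.conjStarAlgEquiv (resolventCalculus hA f) := by
  have hR : resolventAt A' Complex.I = U.conjStarAlgEquiv (resolventAt A Complex.I) := by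
    refine (isResolventAt_resolventAt_I hA').unique ?_
    have := (isResolventAt_resolventAt_I hA).conj U
    rwa [← h] at this
  have hc : Continuous fun f : C(resolventCircle, ℂ) => resolventCalculus hA f :=
    continuous_resolventCalculus hA
  have hc' : Continuous fun f : C(resolventCircle, ℂ) => resolventCalculus hA' f :=
    continuous_resolventCalculus hA'
  have hU : Continuous fun B : E →L[ℂ] E => U.conjStarAlgEquiv B :=
    map_continuous (U.conjStarAlgEquiv)
  induction f using ContinuousMap.induction_on_of_compact with
  | const r =>
    have : ContinuousMap.const resolventCircle r = algebraMap ℂ C(resolventCircle, ℂ) r := rfl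
    rw [this, AlgHomClass.commutes, AlgHomClass.commutes, AlgEquivClass.commutes]
  | id =>
    exact (resolventCalculus_circleCoord hA').trans
      (hR.trans (congrArg _ (resolventCalculus_circleCoord hA).symm))
  | star_id =>
    rw [map_star, map_star, map_star]
    exact congrArg _ ((resolventCalculus_circleCoord hA').trans
      (hR.trans (congrArg _ (resolventCalculus_circleCoord hA).symm)))
  | add f g hf hg => rw [map_add, map_add, map_add, hf, hg]
  | mul f g hf hg => rw [map_mul, map_mul, map_mul, hf, hg]
  | frequently f hf => exact hf.mem_of_closed (isClosed_eq hc' (hU.comp hc))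

end ResolventCalculus

/-! ### Truncated operators and the localised resolvent identity -/

section Truncation

theorem LinearPMap.isSelfAdjoint_of_domain_eq_top {E : Type*} [NormedAddCommGroup E]
    [InnerProductSpace ℂ E] [CompleteSpace E] {A : E →ₗ.[ℂ] E} (htop : A.domain = ⊤)
    (hsymm : ∀ x y : A.domain, ⟪A x, (y : E)⟫_ℂ = ⟪(x : E), A y⟫_ℂ) : IsSelfAdjoint A := by
  have hd : Dense (A.domain : Set E) := by
    rw [htop]
    exact dense_univ
  have hle : A ≤ A.adjoint := LinearPMap.IsFormalAdjoint.le_adjoint hd hsymm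
  have heq : A.domain = A.adjoint.domain := by
    refine le_antisymm hle.1 ?_
    rw [htop]
    exact le_top
  exact (LinearPMap.eq_of_le_of_domain_eq hle heq).symm

theorem inner_deltaVec (x : ℤ) (ψ : EllTwo) : ⟪deltaVec x, ψ⟫_ℂ = ψ x := by
  rw [deltaVec, lp.inner_single_left]
  simp

theorem norm_deltaVec (x : ℤ) : ‖deltaVec x‖ = 1 := by
  rw [deltaVec, lp.norm_single (by norm_num)]
  simp

/-- Symmetry on the whole space also supplies the continuity of the projection, by
Hellinger–Toeplitz. -/
theorem isSymmetric_boxProj (L : ℕ) : (boxProj L).IsSymmetric := by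
  intro φ ψ
  rw [lp.inner_eq_tsum, lp.inner_eq_tsum]
  refine tsum_congr fun n => ?_
  rw [boxProj_apply, boxProj_apply]
  split_ifs <;> simp

/-- Multiplication by the characteristic function of `Λ_L`, as a bounded operator. -/
noncomputable def boxProjL (L : ℕ) : EllTwo →L[ℂ] EllTwo :=
  ((isSymmetric_boxProj L).toSelfAdjoint : EllTwo →L[ℂ] EllTwo)

theorem boxProjL_apply (L : ℕ) (ψ : EllTwo) : boxProjL L ψ = boxProj L ψ := rfl

theorem star_boxProjL (L : ℕ) : star (boxProjL L) = boxProjL L :=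
  (isSymmetric_boxProj L).toSelfAdjoint.2

theorem boxProj_boxProj (L : ℕ) (ψ : EllTwo) : boxProj L (boxProj L ψ) = boxProj L ψ := by
  ext n
  rw [boxProj_apply, boxProj_apply]
  split_ifs <;> rfl

theorem boxProj_deltaVec {L : ℕ} {x : ℤ} (hx : x ∈ box L) :
    boxProj L (deltaVec x) = deltaVec x := by
  ext n
  rw [boxProj_apply]
  split_ifs with hn
  · rfl
  · rw [deltaVec, lp.single_apply_ne]
    rintro rfl
    exact hn hx

theorem norm_boxProjL_le (L : ℕ) : ‖boxProjL L‖ ≤ 1 := by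
  refine ContinuousLinearMap.opNorm_le_bound _ zero_le_one fun ψ => ?_
  rw [one_mul, boxProjL_apply]
  have h1 : ⟪boxProj L ψ, boxProj L ψ⟫_ℂ = ⟪ψ, boxProj L ψ⟫_ℂ := by
    rw [isSymmetric_boxProj, boxProj_boxProj]
  have h2 := norm_inner_le_norm (𝕜 := ℂ) ψ (boxProj L ψ)
  rw [← h1, inner_self_eq_norm_sq_to_K, norm_pow] at h2
  simp only [Complex.coe_algebraMap, Complex.norm_real, norm_norm] at h2
  by_contra hlt
  push Not at hlt
  nlinarith [norm_nonneg ψ]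

theorem boxProj_mem_domain {A : EllTwo →ₗ.[ℂ] EllTwo} (hdom : ∀ x, deltaVec x ∈ A.domain) (L : ℕ)
    (ψ : EllTwo) : boxProj L ψ ∈ A.domain := by
  have : boxProj L ψ = ∑ x ∈ box L, ψ x • deltaVec x := by
    rw [boxProj, LinearMap.sum_apply]
    refine Finset.sum_congr rfl fun x _ => ?_
    change lp.single (E := fun _ : ℤ => ℂ) 2 x (ψ x) = _
    rw [deltaVec, ← lp.single_smul]
    simp
  rw [this]
  exact Submodule.sum_mem _ fun x _ => Submodule.smul_mem _ _ (hdom x)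

variable {A : EllTwo →ₗ.[ℂ] EllTwo}

theorem truncation_domain (hdom : ∀ x, deltaVec x ∈ A.domain) (L : ℕ) :
    (truncation A L).domain = ⊤ :=
  eq_top_iff.2 fun ψ _ => boxProj_mem_domain hdom L ψ

theorem truncation_apply (hdom : ∀ x, deltaVec x ∈ A.domain) (L : ℕ)
    (ψ : (truncation A L).domain) :
    truncation A L ψ = boxProj L (A ⟨boxProj L ψ, boxProj_mem_domain hdom L ψ⟩) := rfl

theorem isSelfAdjoint_truncation (hA : IsSelfAdjoint A) (hdom : ∀ x, deltaVec x ∈ A.domain)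
    (L : ℕ) : IsSelfAdjoint (truncation A L) := by
  refine LinearPMap.isSelfAdjoint_of_domain_eq_top (truncation_domain hdom L) fun φ ψ => ?_
  rw [truncation_apply hdom, truncation_apply hdom, isSymmetric_boxProj, ← isSymmetric_boxProj L φ]
  exact hA.inner_apply_eq ⟨_, boxProj_mem_domain hdom L φ⟩ ⟨_, boxProj_mem_domain hdom L ψ⟩

/-- The reason is P H_L = H_L = H_L P. -/
theorem commute_boxProjL_resolvent (hdom : ∀ x, deltaVec x ∈ A.domain) {L : ℕ} {z : ℂ}
    {R : EllTwo →L[ℂ] EllTwo} (hR : IsResolventAt (truncation A L) z R) :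
    Commute (boxProjL L) R := by
  ext1 ψ
  change boxProj L (R ψ) = R (boxProj L ψ)
  obtain ⟨hd, he⟩ := hR.1 ψ
  have hd' : boxProj L (R ψ) ∈ (truncation A L).domain := by
    rw [truncation_domain hdom]
    trivial
  have h1 : R (truncation A L ⟨boxProj L (R ψ), hd'⟩ - z • boxProj L (R ψ)) = boxProj L (R ψ) :=
    hR.2 ⟨boxProj L (R ψ), hd'⟩
  rw [← h1]
  congr 1
  conv_rhs => rw [← he]
  rw [truncation_apply hdom, truncation_apply hdom]
  simp only [map_sub, map_smul, boxProj_boxProj]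

/-- Subtract R_L(H_L - z)PR = PR from R_L P(H - z)R = R_L P = P R_L. The z-terms cancel and H_L P =
H_L, which leaves -R_L(H_L - PH)R. The bracket takes values in the range of P, so a factor P may be
inserted. The range of R lies in D(H), where T is known. -/
theorem boxProjL_mul_resolvent_sub (hdom : ∀ x, deltaVec x ∈ A.domain) {L : ℕ} {z : ℂ}
    {R RL T : EllTwo →L[ℂ] EllTwo} (hR : IsResolventAt A z R)
    (hRL : IsResolventAt (truncation A L) z RL)
    (hT : ∀ ψ : (truncation A L - (boxProj L).compPMap A).domain,
      T ψ = (truncation A L - (boxProj L).compPMap A) ψ) :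
    boxProjL L * (RL - R) = -(boxProjL L * RL) * T * R := by
  ext1 ψ
  obtain ⟨hd, he⟩ := hR.1 ψ
  have hd' : R ψ ∈ (truncation A L).domain := by
    rw [truncation_domain hdom]
    trivial
  have h1 : T (R ψ) = truncation A L ⟨R ψ, hd'⟩ - boxProj L (A ⟨R ψ, hd⟩) :=
    hT ⟨R ψ, hd', hd⟩
  have h2 : RL (truncation A L ⟨R ψ, hd'⟩ - z • R ψ) = R ψ := hRL.2 ⟨R ψ, hd'⟩
  have hc : ∀ φ, boxProj L (RL φ) = RL (boxProj L φ) := fun φ =>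
    DFunLike.congr_fun (commute_boxProjL_resolvent hdom hRL).eq φ
  have h3 : boxProj L (truncation A L ⟨R ψ, hd'⟩) = truncation A L ⟨R ψ, hd'⟩ := by
    rw [truncation_apply hdom, boxProj_boxProj]
  have h4 := congrArg (boxProj L) h2
  rw [hc, map_sub, map_smul, h3] at h4
  change boxProj L (RL ψ - R ψ) = -(boxProj L (RL (T (R ψ))))
  have h5 := congrArg (boxProj L) he
  rw [map_sub, map_smul] at h5
  rw [h1, map_sub, ← h4, hc, hc, map_sub (boxProj L), boxProj_boxProj, h3, ← h5]
  simp only [map_sub, map_smul]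
  abel

end Truncation

/-! ### Absolute value and polar decomposition -/

section AbsoluteValue

variable {E : Type*} [NormedAddCommGroup E] [InnerProductSpace ℂ E] [CompleteSpace E]

theorem norm_absOp_apply (T : E →L[ℂ] E) (ψ : E) : ‖absOp T ψ‖ = ‖T ψ‖ := by
  have hs : star (absOp T) = absOp T := (IsSelfAdjoint.of_nonneg (CFC.abs_nonneg T)).star_eq
  have h0 : star (absOp T) * absOp T = star T * T := by
    rw [hs]
    exact CFC.abs_mul_abs T
  have key : ∀ B : E →L[ℂ] E, ⟪ψ, (star B * B) ψ⟫_ℂ = ((‖B ψ‖ ^ 2 : ℝ) : ℂ) := by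
    intro B
    rw [mul_apply_eq_comp, ContinuousLinearMap.star_eq_adjoint,
      ContinuousLinearMap.adjoint_inner_right, inner_self_eq_norm_sq_to_K]
    simp
  have h1 := key (absOp T)
  rw [h0, key T] at h1
  have h2 : ‖T ψ‖ ^ 2 = ‖absOp T ψ‖ ^ 2 := by exact_mod_cast h1
  exact ((pow_left_inj₀ (norm_nonneg _) (norm_nonneg _) two_ne_zero).1 h2).symm

/-- An approximate polar decomposition. -/
theorem exists_eq_mul_absOp_add_smul (T : E →L[ℂ] E) {δ : ℝ} (hδ : 0 < δ) :
    ∃ V : E →L[ℂ] E, ‖V‖ ≤ 1 ∧ T = V * absOp T + (δ : ℂ) • V := by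
  have hP : 0 ≤ absOp T := CFC.abs_nonneg T
  have hu : IsUnit (absOp T + algebraMap ℝ (E →L[ℂ] E) δ) := by
    have h1 : -δ ∉ spectrum ℝ (absOp T) := fun h =>
      absurd (spectrum_nonneg_of_nonneg hP h) (by linarith)
    rw [spectrum.notMem_iff, map_neg, ← neg_add', IsUnit.neg_iff, add_comm] at h1
    exact h1
  obtain ⟨u, hu⟩ := hu
  have hδ' : algebraMap ℝ (E →L[ℂ] E) δ = (δ : ℂ) • 1 := by
    rw [Algebra.algebraMap_eq_smul_one]
    rfl
  rw [hδ'] at hu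
  -- V = T(|T| + δ)⁻¹ is a contraction because ‖Tφ‖ = ‖|T|φ‖ ≤ ‖(|T| + δ)φ‖. The shift by δ makes
  -- |T| invertible and avoids a partial isometry.
  refine ⟨T * ↑u⁻¹, ?_, ?_⟩
  · refine ContinuousLinearMap.opNorm_le_bound _ zero_le_one fun ψ => ?_
    set φ := (↑u⁻¹ : E →L[ℂ] E) ψ with hφ
    have h1 : ψ = absOp T φ + (δ : ℂ) • φ := by
      have : (↑u * ↑u⁻¹ : E →L[ℂ] E) ψ = ψ := by rw [u.mul_inv]; rfl
      rw [hu] at this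
      exact this.symm
    have h2 : 0 ≤ (⟪absOp T φ, φ⟫_ℂ).re :=
      ((ContinuousLinearMap.nonneg_iff_isPositive _).1 hP).re_inner_nonneg_left φ
    have h3 : ‖absOp T φ‖ ^ 2 ≤ ‖ψ‖ ^ 2 := by
      rw [h1, @norm_add_sq ℂ, inner_smul_right]
      simp only [RCLike.re_eq_complex_re, Complex.re_ofReal_mul]
      nlinarith [mul_nonneg hδ.le h2, sq_nonneg ‖(δ : ℂ) • φ‖]
    rw [one_mul, mul_apply_eq_comp, ← hφ, ← norm_absOp_apply]
    exact (pow_le_pow_iff_left₀ (norm_nonneg _) (norm_nonneg _) two_ne_zero).1 h3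
  · have h1 : T * ↑u⁻¹ * absOp T + (δ : ℂ) • (T * ↑u⁻¹) =
        T * (↑u⁻¹ * (absOp T + (δ : ℂ) • 1)) := by
      rw [mul_add, mul_add, mul_smul_comm, mul_one, mul_smul_comm, mul_assoc]
    rw [h1, ← hu, u.inv_mul, mul_one]

theorem exists_star_eq_mul_self_eq_absOp (T : E →L[ℂ] E) :
    ∃ S : E →L[ℂ] E, star S = S ∧ S * S = absOp T :=
  ⟨CFC.sqrt (absOp T), (IsSelfAdjoint.of_nonneg (CFC.sqrt_nonneg _)).star_eq,
    CFC.sqrt_mul_sqrt_self _ (CFC.abs_nonneg T)⟩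

end AbsoluteValue

/-! ### The trace inequality -/

section TraceInequality

theorem hasSum_norm_sq (ψ : EllTwo) : HasSum (fun n => ‖ψ n‖ ^ 2) (‖ψ‖ ^ 2) := by
  have := lp.hasSum_norm (p := 2) (by norm_num) ψ
  simpa using this

/-- A Hilbert–Schmidt bound: expand in matrix elements, exchange the two sums, and estimate
‖X†S†δ_y‖ ≤ ‖X‖‖S†δ_y‖. -/
theorem sum_norm_sq_mul_le {S X : EllTwo →L[ℂ] EllTwo}
    (hS : Summable fun y => ‖star S (deltaVec y)‖ ^ 2) (s : Finset ℤ) :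
    ∑ x ∈ s, ‖S (X (deltaVec x))‖ ^ 2 ≤ ‖X‖ ^ 2 * ∑' y, ‖star S (deltaVec y)‖ ^ 2 := by
  have h1 : ∀ x y, ‖S (X (deltaVec x)) y‖ = ‖star X (star S (deltaVec y)) x‖ := by
    intro x y
    rw [← inner_deltaVec, ← inner_deltaVec, ContinuousLinearMap.star_eq_adjoint,
      ContinuousLinearMap.star_eq_adjoint, ContinuousLinearMap.adjoint_inner_right,
      ← ContinuousLinearMap.adjoint_inner_left, norm_inner_symm]
  have h2 : HasSum (fun y => ∑ x ∈ s, ‖star X (star S (deltaVec y)) x‖ ^ 2)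
      (∑ x ∈ s, ‖S (X (deltaVec x))‖ ^ 2) := by
    refine hasSum_sum fun x _ => ?_
    simp only [← h1]
    exact hasSum_norm_sq _
  rw [← h2.tsum_eq, ← tsum_mul_left]
  refine h2.summable.tsum_le_tsum (fun y => ?_) (hS.mul_left _)
  refine ((hasSum_norm_sq _).summable.sum_le_tsum s fun _ _ => by positivity).trans ?_
  rw [(hasSum_norm_sq _).tsum_eq, ← mul_pow]
  refine pow_le_pow_left₀ (norm_nonneg _) ?_ 2
  refine (ContinuousLinearMap.le_opNorm _ _).trans ?_
  rw [ContinuousLinearMap.star_eq_adjoint, LinearIsometryEquiv.norm_map]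

/-- The trace inequality `|∑ₓ ⟨δ_x, Y T Z δ_x⟩| ≤ ‖Y‖ ‖Z‖ tr |T|`. -/
theorem IsTraceClass.norm_sum_inner_le {T : EllTwo →L[ℂ] EllTwo} (hT : IsTraceClass T)
    (Y Z : EllTwo →L[ℂ] EllTwo) (s : Finset ℤ) :
    ‖∑ x ∈ s, ⟪deltaVec x, (Y * T * Z) (deltaVec x)⟫_ℂ‖ ≤ trAbs T * (‖Y‖ * ‖Z‖) := by
  -- S = |T|^{1/2} has squared Hilbert–Schmidt norm tr|T|. Splitting T ≈ V S S and applying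
  -- Cauchy–Schwarz puts one factor S on each side.
  obtain ⟨S, hSs, hSS⟩ := exists_star_eq_mul_self_eq_absOp T
  have hsq : ∀ y, ‖star S (deltaVec y)‖ ^ 2 = (⟪deltaVec y, absOp T (deltaVec y)⟫_ℂ).re := by
    intro y
    rw [← hSS]
    nth_rw 2 [← hSs]
    rw [mul_apply_eq_comp, ContinuousLinearMap.star_eq_adjoint,
      ContinuousLinearMap.adjoint_inner_right, ← ContinuousLinearMap.star_eq_adjoint, hSs,
      inner_self_eq_norm_sq_to_K]
    norm_cast
  have hS : Summable fun y => ‖star S (deltaVec y)‖ ^ 2 := by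
    simp only [hsq]
    exact hT
  have htr : ∑' y, ‖star S (deltaVec y)‖ ^ 2 = trAbs T := tsum_congr hsq
  have htr0 : 0 ≤ trAbs T := by
    rw [← htr]
    positivity
  have hδ : ∀ δ : ℝ, 0 < δ → ‖∑ x ∈ s, ⟪deltaVec x, (Y * T * Z) (deltaVec x)⟫_ℂ‖ ≤
      trAbs T * (‖Y‖ * ‖Z‖) + δ * (s.card * (‖Y‖ * ‖Z‖)) := by
    intro δ hδ
    obtain ⟨V, hV, hTV⟩ := exists_eq_mul_absOp_add_smul T hδ
    have hterm : ∀ x, ‖⟪deltaVec x, (Y * T * Z) (deltaVec x)⟫_ℂ‖ ≤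
        ‖S (star (Y * V) (deltaVec x))‖ * ‖S (Z (deltaVec x))‖ + δ * (‖Y‖ * ‖Z‖) := by
      intro x
      have h1 : Y * T * Z = Y * V * (S * (S * Z)) + (δ : ℂ) • (Y * V * Z) := by
        conv_lhs => rw [hTV, ← hSS]
        simp only [mul_add, add_mul, mul_assoc, mul_smul_comm, smul_mul_assoc]
      have h2 : ⟪deltaVec x, (Y * V * (S * (S * Z))) (deltaVec x)⟫_ℂ =
          ⟪S (star (Y * V) (deltaVec x)), S (Z (deltaVec x))⟫_ℂ := by
        conv_rhs => rw [← ContinuousLinearMap.adjoint_inner_right,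
          ← ContinuousLinearMap.star_eq_adjoint, hSs, ContinuousLinearMap.star_eq_adjoint,
          ContinuousLinearMap.adjoint_inner_left]
        rfl
      rw [h1, add_apply, inner_add_right, h2, smul_apply, inner_smul_right]
      refine (norm_add_le _ _).trans (add_le_add (norm_inner_le_norm _ _) ?_)
      rw [norm_mul, Complex.norm_real, Real.norm_of_nonneg hδ.le]
      refine mul_le_mul_of_nonneg_left ?_ hδ.le
      refine (norm_inner_le_norm _ _).trans ?_
      rw [norm_deltaVec, one_mul]
      refine (ContinuousLinearMap.le_opNorm _ _).trans ?_
      rw [norm_deltaVec, mul_one]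
      refine (norm_mul_le _ _).trans (mul_le_mul_of_nonneg_right ?_ (norm_nonneg _))
      exact (norm_mul_le _ _).trans (mul_le_of_le_one_right (norm_nonneg _) hV)
    refine (norm_sum_le _ _).trans ((Finset.sum_le_sum fun x _ => hterm x).trans ?_)
    rw [Finset.sum_add_distrib, Finset.sum_const, nsmul_eq_mul]
    refine add_le_add ?_ (by rw [mul_left_comm])
    refine (Real.sum_mul_le_sqrt_mul_sqrt _ _ _).trans ?_
    have h1 : √(∑ x ∈ s, ‖S (star (Y * V) (deltaVec x))‖ ^ 2) ≤ ‖Y‖ * √(trAbs T) := by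
      refine Real.sqrt_le_iff.2 ⟨by positivity, (sum_norm_sq_mul_le hS s).trans ?_⟩
      rw [htr, mul_pow, Real.sq_sqrt htr0, ContinuousLinearMap.star_eq_adjoint,
        LinearIsometryEquiv.norm_map]
      refine mul_le_mul_of_nonneg_right (pow_le_pow_left₀ (norm_nonneg _) ?_ 2) htr0
      exact (norm_mul_le _ _).trans (mul_le_of_le_one_right (norm_nonneg _) hV)
    have h2 : √(∑ x ∈ s, ‖S (Z (deltaVec x))‖ ^ 2) ≤ ‖Z‖ * √(trAbs T) := by
      refine Real.sqrt_le_iff.2 ⟨by positivity, (sum_norm_sq_mul_le hS s).trans ?_⟩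
      rw [htr, mul_pow, Real.sq_sqrt htr0]
    refine (mul_le_mul h1 h2 (Real.sqrt_nonneg _) (by positivity)).trans (le_of_eq ?_)
    rw [mul_mul_mul_comm, Real.mul_self_sqrt htr0, mul_comm]
  -- The sum over s is finite, so the error of the polar decomposition vanishes as δ ↓ 0.
  have hlim : Tendsto (fun δ : ℝ => trAbs T * (‖Y‖ * ‖Z‖) + δ * (s.card * (‖Y‖ * ‖Z‖))) (𝓝[>] 0)
      (𝓝 (trAbs T * (‖Y‖ * ‖Z‖) + 0 * (s.card * (‖Y‖ * ‖Z‖)))) :=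
    ((tendsto_id.mul_const _).const_add _).mono_left nhdsWithin_le_nhds
  rw [zero_mul, add_zero] at hlim
  exact ge_of_tendsto hlim (eventually_nhdsWithin_of_forall hδ)

end TraceInequality

/-! ### Negligibility per unit volume and replacement of H_L by H -/

section TraceNegligible

/-- The operators `X_L` are negligible in the trace per unit volume, also after multiplication
with bounded operators from both sides. -/
def TraceNegligible (X : ℕ → EllTwo →L[ℂ] EllTwo) : Prop :=
  ∀ η > 0, ∀ᶠ L in atTop, ∀ Y Z : EllTwo →L[ℂ] EllTwo,
    ‖∑ x ∈ box L, ⟪deltaVec x, (Y * X L * Z) (deltaVec x)⟫_ℂ‖ ≤ η * (box L).card * (‖Y‖ * ‖Z‖)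

theorem TraceNegligible.add {X X' : ℕ → EllTwo →L[ℂ] EllTwo} (h : TraceNegligible X)
    (h' : TraceNegligible X') : TraceNegligible fun L => X L + X' L := by
  intro η hη
  filter_upwards [h (η / 2) (half_pos hη), h' (η / 2) (half_pos hη)] with L h1 h2 Y Z
  have : ∑ x ∈ box L, ⟪deltaVec x, (Y * (X L + X' L) * Z) (deltaVec x)⟫_ℂ =
      ∑ x ∈ box L, ⟪deltaVec x, (Y * X L * Z) (deltaVec x)⟫_ℂ +
        ∑ x ∈ box L, ⟪deltaVec x, (Y * X' L * Z) (deltaVec x)⟫_ℂ := by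
    rw [← Finset.sum_add_distrib]
    simp only [mul_add, add_mul, add_apply, inner_add_right]
  rw [this]
  refine (norm_add_le _ _).trans ((add_le_add (h1 Y Z) (h2 Y Z)).trans (le_of_eq ?_))
  ring

/-- The factors are absorbed into Y and Z; this is why negligibility is required uniformly in them.
-/
theorem TraceNegligible.mul_mul {X : ℕ → EllTwo →L[ℂ] EllTwo} (h : TraceNegligible X)
    {B C : ℕ → EllTwo →L[ℂ] EllTwo} {b c : ℝ} (hB : ∀ L, ‖B L‖ ≤ b) (hC : ∀ L, ‖C L‖ ≤ c) :
    TraceNegligible fun L => B L * X L * C L := by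
  intro η hη
  have hb : 0 ≤ b := (norm_nonneg _).trans (hB 0)
  have hc : 0 ≤ c := (norm_nonneg _).trans (hC 0)
  -- The summand 1 covers the case b c = 0.
  filter_upwards [h (η / (b * c + 1)) (by positivity)] with L h1 Y Z
  have h2 : Y * (B L * X L * C L) * Z = (Y * B L) * X L * (C L * Z) := by
    simp only [mul_assoc]
  rw [h2]
  have h3 : ‖Y * B L‖ ≤ ‖Y‖ * b :=
    (norm_mul_le _ _).trans (mul_le_mul_of_nonneg_left (hB L) (norm_nonneg _))
  have h4 : ‖C L * Z‖ ≤ c * ‖Z‖ :=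
    (norm_mul_le _ _).trans (mul_le_mul_of_nonneg_right (hC L) (norm_nonneg _))
  refine (h1 _ _).trans ?_
  calc η / (b * c + 1) * (box L).card * (‖Y * B L‖ * ‖C L * Z‖)
      ≤ η / (b * c + 1) * (box L).card * ((‖Y‖ * b) * (c * ‖Z‖)) := by gcongr
    _ = η * (box L).card * (‖Y‖ * ‖Z‖) * ((b * c) / (b * c + 1)) := by ring
    _ ≤ η * (box L).card * (‖Y‖ * ‖Z‖) * 1 := by
        gcongr
        rw [div_le_one (by positivity)]
        linarith
    _ = _ := mul_one _

theorem norm_sum_inner_mul_mul_le (X Y Z : EllTwo →L[ℂ] EllTwo) (s : Finset ℤ) :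
    ‖∑ x ∈ s, ⟪deltaVec x, (Y * X * Z) (deltaVec x)⟫_ℂ‖ ≤ ‖X‖ * s.card * (‖Y‖ * ‖Z‖) := by
  refine (norm_sum_le_of_le s (f := fun x => ⟪deltaVec x, (Y * X * Z) (deltaVec x)⟫_ℂ)
    (n := fun _ => ‖Y‖ * ‖X‖ * ‖Z‖) fun x _ => ?_).trans (le_of_eq ?_)
  · refine (norm_inner_le_norm _ _).trans ?_
    rw [norm_deltaVec, one_mul]
    refine (ContinuousLinearMap.le_opNorm _ _).trans ?_
    rw [norm_deltaVec, mul_one]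
    exact (norm_mul_le _ _).trans (mul_le_mul_of_nonneg_right (norm_mul_le _ _) (norm_nonneg _))
  · rw [Finset.sum_const, nsmul_eq_mul]
    ring

/-- An operator of norm η contributes at most η per site. This is the closure under uniform limits
used with Stone–Weierstrass. -/
theorem TraceNegligible.of_approx {X : ℕ → EllTwo →L[ℂ] EllTwo}
    (h : ∀ η > 0, ∃ X' : ℕ → EllTwo →L[ℂ] EllTwo, TraceNegligible X' ∧ ∀ L, ‖X L - X' L‖ ≤ η) :
    TraceNegligible X := by
  intro η hη
  obtain ⟨X', hX', hd⟩ := h (η / 2) (half_pos hη)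
  filter_upwards [hX' (η / 2) (half_pos hη)] with L h1 Y Z
  have : ∑ x ∈ box L, ⟪deltaVec x, (Y * X L * Z) (deltaVec x)⟫_ℂ =
      ∑ x ∈ box L, ⟪deltaVec x, (Y * X' L * Z) (deltaVec x)⟫_ℂ +
        ∑ x ∈ box L, ⟪deltaVec x, (Y * (X L - X' L) * Z) (deltaVec x)⟫_ℂ := by
    rw [← Finset.sum_add_distrib]
    refine Finset.sum_congr rfl fun x _ => ?_
    rw [← inner_add_right, ← add_apply, ← add_mul, ← mul_add, add_sub_cancel]
  rw [this]
  refine (norm_add_le _ _).trans ((add_le_add (h1 Y Z)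
    (norm_sum_inner_mul_mul_le _ Y Z (box L))).trans ?_)
  calc η / 2 * (box L).card * (‖Y‖ * ‖Z‖) + ‖X L - X' L‖ * (box L).card * (‖Y‖ * ‖Z‖)
      ≤ η / 2 * (box L).card * (‖Y‖ * ‖Z‖) + η / 2 * (box L).card * (‖Y‖ * ‖Z‖) := by
        gcongr
        exact hd L
    _ = _ := by ring

theorem TraceNegligible.of_trAbs_le {ε : ℕ → ℝ} (hε : Tendsto ε atTop (𝓝 0))
    {T : ℕ → EllTwo →L[ℂ] EllTwo} (hT : ∀ L, 0 < L → IsTraceClass (T L))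
    (hle : ∀ L, 0 < L → trAbs (T L) ≤ ε L * (box L).card) : TraceNegligible T := by
  intro η hη
  filter_upwards [hε.eventually_le_const hη, eventually_gt_atTop 0] with L h1 h2 Y Z
  refine ((hT L h2).norm_sum_inner_le Y Z _).trans ?_
  refine mul_le_mul_of_nonneg_right ((hle L h2).trans ?_) (by positivity)
  gcongr

theorem TraceNegligible.congr {X X' : ℕ → EllTwo →L[ℂ] EllTwo} (h : TraceNegligible X)
    (he : ∀ L, 0 < L → X L = X' L) : TraceNegligible X' := by
  intro η hη
  filter_upwards [h η hη, eventually_gt_atTop 0] with L h1 h2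
  rwa [← he L h2]

theorem TraceNegligible.tendsto {X : ℕ → EllTwo →L[ℂ] EllTwo} (h : TraceNegligible X) :
    Tendsto (fun L => ((box L).card : ℂ)⁻¹ * ∑ x ∈ box L, ⟪deltaVec x, X L (deltaVec x)⟫_ℂ)
      atTop (𝓝 0) := by
  refine NormedAddGroup.tendsto_nhds_zero.2 fun η hη => ?_
  filter_upwards [h (η / 2) (half_pos hη)] with L h1
  have h2 := h1 1 1
  simp only [one_mul, mul_one] at h2
  have hc : (0 : ℝ) < (box L).card := by
    rw [card_box]
    positivity
  have h3 : ‖(1 : EllTwo →L[ℂ] EllTwo)‖ ≤ 1 := ContinuousLinearMap.norm_id_le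
  rw [norm_mul, norm_inv, Complex.norm_natCast]
  calc ((box L).card : ℝ)⁻¹ * ‖∑ x ∈ box L, ⟪deltaVec x, X L (deltaVec x)⟫_ℂ‖
      ≤ ((box L).card : ℝ)⁻¹ * (η / 2 * (box L).card * (1 * 1)) := by
        gcongr
        refine h2.trans ?_
        gcongr
    _ = η / 2 := by field_simp
    _ < η := half_lt_self hη

theorem commute_resolventCalculus {E : Type*} [NormedAddCommGroup E] [InnerProductSpace ℂ E]
    [CompleteSpace E] {A : E →ₗ.[ℂ] E} (hA : IsSelfAdjoint A) {B : E →L[ℂ] E} (hB : star B = B)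
    (h : Commute B (resolventAt A Complex.I)) (f : C(resolventCircle, ℂ)) :
    Commute B (resolventCalculus hA f) := by
  have hid : Commute B (resolventCalculus hA circleCoord) := by
    rwa [resolventCalculus_circleCoord hA]
  induction f using ContinuousMap.induction_on_of_compact with
  | const r =>
    have : ContinuousMap.const resolventCircle r = algebraMap ℂ C(resolventCircle, ℂ) r := rfl
    rw [this, AlgHomClass.commutes]
    exact (Algebra.commutes r B).symm
  | id => exact hid
  | star_id =>
    rw [map_star]
    nth_rw 1 [← hB]
    exact hid.star_star
  | add f g hf hg =>
    rw [map_add]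
    exact hf.add_right hg
  | mul f g hf hg =>
    rw [map_mul]
    exact hf.mul_right hg
  | frequently f hf =>
    have hc := continuous_resolventCalculus hA
    exact hf.mem_of_closed (isClosed_eq (continuous_const.mul hc) (hc.mul continuous_const))

variable {A : EllTwo →ₗ.[ℂ] EllTwo} {ε : ℕ → ℝ}

theorem traceNegligible_resolvent_sub (hdom : ∀ x, deltaVec x ∈ A.domain)
    (hε : Tendsto ε atTop (𝓝 0))
    (htr : ∀ L, 0 < L → TraceClassWithBound (truncation A L - (boxProj L).compPMap A)
      (ε L * ((box L).card : ℝ)))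
    {z : ℂ} {R : EllTwo →L[ℂ] EllTwo} {RL : ℕ → EllTwo →L[ℂ] EllTwo} {c : ℝ}
    (hR : IsResolventAt A z R) (hRL : ∀ L, IsResolventAt (truncation A L) z (RL L))
    (hc : ∀ L, ‖RL L‖ ≤ c) : TraceNegligible fun L => boxProjL L * (RL L - R) := by
  choose! T hT1 hT2 hT3 using fun L hL => (htr L hL).2
  have h1 := (TraceNegligible.of_trAbs_le hε hT2 hT3).mul_mul
    (B := fun L => -(boxProjL L * RL L)) (C := fun _ => R) (b := 1 * c) (c := ‖R‖) (fun L => by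
      rw [norm_neg]
      exact (norm_mul_le _ _).trans
        (mul_le_mul (norm_boxProjL_le L) (hc L) (norm_nonneg _) zero_le_one)) fun _ => le_rfl
  exact h1.congr fun L hL => (boxProjL_mul_resolvent_sub hdom hR (hRL L) (hT1 L hL)).symm

/-- Stone–Weierstrass induction: the generators w and w̄ are the resolvents at i and -i, for which
the localised resolvent identity and the trace bound apply. -/
theorem traceNegligible_resolventCalculus_sub (hA : IsSelfAdjoint A)
    (hdom : ∀ x, deltaVec x ∈ A.domain) (hε : Tendsto ε atTop (𝓝 0))
    (htr : ∀ L, 0 < L → TraceClassWithBound (truncation A L - (boxProj L).compPMap A)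
      (ε L * ((box L).card : ℝ))) (f : C(resolventCircle, ℂ)) :
    TraceNegligible fun L => boxProjL L *
      (resolventCalculus (isSelfAdjoint_truncation hA hdom L) f - resolventCalculus hA f) := by
  have hAL := isSelfAdjoint_truncation hA hdom
  have hnL : ∀ f L, ‖resolventCalculus (hAL L) f‖ ≤ ‖f‖ := fun f L =>
    norm_resolventCalculus_le (hAL L) f
  induction f using ContinuousMap.induction_on_of_compact with
  | const r =>
    have : ContinuousMap.const resolventCircle r = algebraMap ℂ C(resolventCircle, ℂ) r := rfl
    intro η hη
    refine Eventually.of_forall fun L Y Z => ?_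
    simp only [this, AlgHomClass.commutes, sub_self, mul_zero, zero_mul, zero_apply, inner_zero_right, Finset.sum_const_zero, norm_zero]
    positivity
  | id =>
    exact traceNegligible_resolvent_sub (z := Complex.I) hdom hε htr
      (by
        have := isResolventAt_resolventAt_I hA
        rwa [← resolventCalculus_circleCoord hA] at this)
      (fun L => by
        have := isResolventAt_resolventAt_I (hAL L)
        rwa [← resolventCalculus_circleCoord (hAL L)] at this) (hnL _)
  | star_id =>
    exact traceNegligible_resolvent_sub (z := -Complex.I) hdom hε htr
      (by
        have := star_isResolventAt hA
        rwa [← resolventCalculus_circleCoord hA, ← map_star] at this)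
      (fun L => by
        have := star_isResolventAt (hAL L)
        rwa [← resolventCalculus_circleCoord (hAL L), ← map_star] at this) (hnL _)
  | add f g hf hg =>
    refine (hf.add hg).congr fun L _ => ?_
    rw [map_add, map_add, ← mul_add, add_sub_add_comm]
  | mul f g hf hg =>
    have h1 : ∀ L, ‖(1 : EllTwo →L[ℂ] EllTwo)‖ ≤ (fun _ => 1 : ℕ → ℝ) L := fun _ =>
      ContinuousLinearMap.norm_id_le
    -- P((fg)(R_L) - (fg)(R)) = f(R_L) P (g(R_L) - g(R)) + P(f(R_L) - f(R)) g(R), where P has been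
    -- commuted past f(R_L).
    refine ((hg.mul_mul (hnL f) h1).add
      (hf.mul_mul h1 (C := fun _ => resolventCalculus hA g) fun _ => le_rfl)).congr fun L _ => ?_
    have hcomm := commute_resolventCalculus (hAL L) (star_boxProjL L)
      (commute_boxProjL_resolvent hdom (isResolventAt_resolventAt_I (hAL L))) f
    rw [mul_one, one_mul, ← mul_assoc, ← hcomm.eq, map_mul, map_mul]
    simp only [mul_assoc, mul_sub, sub_mul]
    abel
  | frequently f hf =>
    refine TraceNegligible.of_approx fun η hη => ?_
    obtain ⟨g, hg, hfg⟩ := (hf.and_eventually (Metric.ball_mem_nhds f (half_pos hη))).exists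
    refine ⟨_, hg, fun L => ?_⟩
    have h1 : ‖f - g‖ ≤ η / 2 := by
      rw [← dist_eq_norm, dist_comm]
      exact (Metric.mem_ball.1 hfg).le
    have h2 := (norm_resolventCalculus_le hA (f - g)).trans h1
    have h3 := (norm_resolventCalculus_le (hAL L) (f - g)).trans h1
    rw [← mul_sub, sub_sub_sub_comm, ← map_sub, ← map_sub]
    refine (norm_mul_le _ _).trans ((mul_le_of_le_one_left (norm_nonneg _)
      (norm_boxProjL_le L)).trans ((norm_sub_le _ _).trans ?_))
    linarith

/-- The averaged diagonal matrix elements of functions of the truncated and of the full operator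
are asymptotically equal. -/
theorem tendsto_boxAverage_sub (hA : IsSelfAdjoint A)
    (hdom : ∀ x, deltaVec x ∈ A.domain) (hε : Tendsto ε atTop (𝓝 0))
    (htr : ∀ L, 0 < L → TraceClassWithBound (truncation A L - (boxProj L).compPMap A)
      (ε L * ((box L).card : ℝ))) (g : C₀(ℝ, ℂ)) :
    Tendsto (fun L => boxAverage A L g -
      ((box L).card : ℂ)⁻¹ * ∑ x ∈ box L, ⟪deltaVec x, applyFun g A (deltaVec x)⟫_ℂ)
      atTop (𝓝 0) := by
  refine (traceNegligible_resolventCalculus_sub hA hdom hε htr (circleLift g)).tendsto.congr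
    fun L => ?_
  rw [boxAverage, ← mul_sub, ← Finset.sum_sub_distrib]
  congr 1
  refine Finset.sum_congr rfl fun x hx => ?_
  -- By symmetry P moves onto δ_x, which it fixes for x in the box.
  rw [applyFun_eq_resolventCalculus hA,
    applyFun_eq_resolventCalculus (isSelfAdjoint_truncation hA hdom L), ← inner_sub_right,
    mul_apply_eq_comp, boxProjL_apply, ← isSymmetric_boxProj, boxProj_deltaVec hx, sub_apply]

end TraceNegligible

/-! ### States on C₀(ℝ), their measures, and weak convergence -/

section StateFunctional

open scoped ComplexOrder

/-- The continuous function with values in `[0, 1]` that is `1` on `[-(n + 1), n + 1]` and `0`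
outside `[-(n + 2), n + 2]`. -/
noncomputable def cutoff (n : ℕ) : C_c(ℝ, ℝ) where
  toFun t := max 0 (min 1 ((n : ℝ) + 2 - |t|))
  continuous_toFun := by fun_prop
  hasCompactSupport' := by
    refine HasCompactSupport.intro (isCompact_Icc (a := -((n : ℝ) + 2)) (b := (n : ℝ) + 2))
      fun t ht => ?_
    rw [Set.mem_Icc, ← abs_le, not_le] at ht
    exact max_eq_left ((min_le_right _ _).trans (by linarith))

theorem cutoff_apply (n : ℕ) (t : ℝ) : cutoff n t = max 0 (min 1 ((n : ℝ) + 2 - |t|)) := rfl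

theorem cutoff_nonneg (n : ℕ) (t : ℝ) : 0 ≤ cutoff n t := le_max_left _ _

theorem cutoff_le_one (n : ℕ) (t : ℝ) : cutoff n t ≤ 1 :=
  max_le zero_le_one (min_le_left _ _)

theorem cutoff_eq_one {n : ℕ} {t : ℝ} (h : |t| ≤ n + 1) : cutoff n t = 1 := by
  rw [cutoff_apply, min_eq_left (by linarith), max_eq_right zero_le_one]

theorem cutoff_mono (t : ℝ) : Monotone fun n => cutoff n t := by
  intro m n h
  simp only [cutoff_apply]
  gcongr

theorem cutoff_tendsto_one (t : ℝ) : Tendsto (fun n => cutoff n t) atTop (𝓝 1) := by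
  refine tendsto_const_nhds.congr' ?_
  filter_upwards [eventually_ge_atTop ⌈|t|⌉₊] with n hn
  exact (cutoff_eq_one (by linarith [Nat.ceil_le.1 hn])).symm

/-- A real compactly supported function, regarded as a complex one. -/
noncomputable def complexify (f : C_c(ℝ, ℝ)) : C_c(ℝ, ℂ) :=
  f.compLeft ⟨fun x : ℝ => (x : ℂ), Complex.continuous_ofReal⟩

theorem complexify_apply (f : C_c(ℝ, ℝ)) (t : ℝ) : complexify f t = (f t : ℂ) :=
  CompactlySupportedContinuousMap.compLeft_apply Complex.ofReal_zero f t

/-- A positive linear functional on `C₀(ℝ)` of total mass one. -/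
structure IsStateFunctional (I : (ℝ → ℂ) → ℂ) : Prop where
  add : ∀ f g : C₀(ℝ, ℂ), I (f + g : C₀(ℝ, ℂ)) = I f + I g
  smul : ∀ (c : ℂ) (f : C₀(ℝ, ℂ)), I (c • f : C₀(ℝ, ℂ)) = c * I f
  nonneg : ∀ f : C₀(ℝ, ℂ), (∀ t, 0 ≤ f t) → 0 ≤ I f
  tendsto_cutoff : Tendsto (fun n => I (complexify (cutoff n))) atTop (𝓝 1)

variable {I : (ℝ → ℂ) → ℂ} {k : Measure ℝ}

theorem IsRieszMeasure.integral_real (hk : IsRieszMeasure I k) (f : C_c(ℝ, ℝ)) :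
    ((∫ t, f t ∂k : ℝ) : ℂ) = I (complexify f) := by
  rw [← hk.2]
  simp only [complexify_apply]
  exact integral_ofReal.symm

/-- The real Riesz–Markov theorem is applied to the real part of I on real functions; the complex
case follows by linearity. -/
theorem IsStateFunctional.exists_isRieszMeasure (hI : IsStateFunctional I) :
    ∃ k, IsRieszMeasure I k := by
  have hadd : ∀ f g : C_c(ℝ, ℂ), I (f + g : C_c(ℝ, ℂ)) = I f + I g := fun f g => hI.add f g
  have hsmul : ∀ (c : ℂ) (f : C_c(ℝ, ℂ)), I (c • f : C_c(ℝ, ℂ)) = c * I f := fun c f => hI.smul c f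
  let Λ₀ : C_c(ℝ, ℝ) →ₗ[ℝ] ℝ :=
    { toFun := fun f => (I (complexify f)).re
      map_add' := fun f g => by
        have : complexify (f + g) = complexify f + complexify g := by
          ext t
          simp [complexify_apply]
        rw [this, hadd, Complex.add_re]
      map_smul' := fun c f => by
        have : complexify (c • f) = (c : ℂ) • complexify f := by
          ext t
          simp [complexify_apply]
        rw [this, hsmul, Complex.re_ofReal_mul]
        rfl }
  have hnn : ∀ f : C_c(ℝ, ℝ), 0 ≤ f → 0 ≤ I (complexify f) := by
    intro f hf
    refine hI.nonneg (complexify f : C₀(ℝ, ℂ)) fun t => ?_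
    change 0 ≤ complexify f t
    rw [complexify_apply]
    exact_mod_cast hf t
  let Λ : C_c(ℝ, ℝ) →ₚ[ℝ] ℝ := PositiveLinearMap.mk₀ Λ₀ fun f hf => (Complex.le_def.1 (hnn f hf)).1
  -- Positivity makes I real on f⁺ and f⁻, hence on f = f⁺ - f⁻.
  have him : ∀ f : C_c(ℝ, ℝ), ((I (complexify f)).re : ℂ) = I (complexify f) := by
    intro f
    let p : C_c(ℝ, ℝ) := f ⊔ 0
    let q : C_c(ℝ, ℝ) := (-f) ⊔ 0
    have hpq : complexify f = complexify p + (-1 : ℂ) • complexify q := by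
      ext t
      have : f t = max (f t) 0 - max (-f t) 0 := by
        rcases le_total 0 (f t) with h | h <;> simp [h]
      simp only [CompactlySupportedContinuousMap.add_apply,
        CompactlySupportedContinuousMap.smul_apply, complexify_apply]
      change ((f t : ℝ) : ℂ) = ((max (f t) 0 : ℝ) : ℂ) + (-1 : ℂ) • ((max (-f t) 0 : ℝ) : ℂ)
      conv_lhs => rw [this]
      push_cast
      simp [sub_eq_add_neg]
    have hp := (Complex.le_def.1 (hnn p le_sup_right)).2
    have hq := (Complex.le_def.1 (hnn q le_sup_right)).2
    refine Complex.ext rfl ?_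
    rw [hpq, hadd, hsmul]
    simp at hp hq ⊢
    rw [← hp, ← hq]
    simp
  let μ := RealRMK.rieszMeasure Λ
  have hμ : ∀ f : C_c(ℝ, ℝ), ∫ t, f t ∂μ = Λ f := RealRMK.integral_rieszMeasure Λ
  have hreg : μ.Regular := RealRMK.regular_rieszMeasure Λ
  refine ⟨μ, hreg, fun g => ?_⟩
  let u : C_c(ℝ, ℝ) := g.compLeft ⟨Complex.re, Complex.continuous_re⟩
  let v : C_c(ℝ, ℝ) := g.compLeft ⟨Complex.im, Complex.continuous_im⟩
  have hu : ∀ t, u t = (g t).re := CompactlySupportedContinuousMap.compLeft_apply rfl g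
  have hv : ∀ t, v t = (g t).im := CompactlySupportedContinuousMap.compLeft_apply rfl g
  have hg : g = complexify u + Complex.I • complexify v := by
    ext t
    simp only [CompactlySupportedContinuousMap.add_apply,
      CompactlySupportedContinuousMap.smul_apply, complexify_apply, hu, hv, smul_eq_mul]
    rw [mul_comm, Complex.re_add_im]
  have hint : Integrable g μ :=
    g.continuous.integrable_of_hasCompactSupport g.hasCompactSupport
  have h1 : ((∫ t, u t ∂μ : ℝ) : ℂ) = I (complexify u) := by
    rw [hμ]
    exact him u
  have h2 : ((∫ t, v t ∂μ : ℝ) : ℂ) = I (complexify v) := by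
    rw [hμ]
    exact him v
  have h3 : ((∫ t, u t ∂μ : ℝ) : ℂ) +
      ((∫ t, v t ∂μ : ℝ) : ℂ) * Complex.I =
      ∫ t, g t ∂μ := by
    simp only [hu, hv]
    exact integral_re_add_im hint
  rw [← h3, h1, h2]
  conv_rhs => rw [hg]
  rw [hadd, hsmul, mul_comm]

theorem IsRieszMeasure.unique {k k' : Measure ℝ} (hk : IsRieszMeasure I k)
    (hk' : IsRieszMeasure I k') : k = k' := by
  have := hk.1
  have := hk'.1
  refine Measure.ext_of_integral_eq_on_compactlySupported fun f => ?_
  have h := (hk.integral_real f).trans (hk'.integral_real f).symm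
  exact_mod_cast h

theorem IsStateFunctional.existsUnique_isRieszMeasure (hI : IsStateFunctional I) :
    ∃! k, IsRieszMeasure I k := by
  obtain ⟨k, hk⟩ := hI.exists_isRieszMeasure
  exact ⟨k, hk, fun k' hk' => hk'.unique hk⟩

/-- The cutoffs increase to 1, so monotone convergence identifies the total mass with lim I(cutoff)
= 1, without prior knowledge that k is finite. -/
theorem IsStateFunctional.isProbabilityMeasure (hI : IsStateFunctional I)
    (hk : IsRieszMeasure I k) : IsProbabilityMeasure k := by
  have := hk.1
  have h1 : Tendsto (fun n => ∫ t, cutoff n t ∂k) atTop (𝓝 1) := by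
    have h := (Complex.continuous_re.tendsto _).comp hI.tendsto_cutoff
    rw [Complex.one_re] at h
    refine h.congr fun n => ?_
    simp only [Function.comp]
    rw [← hk.integral_real, Complex.ofReal_re]
  have h2 : Tendsto (fun n => ∫⁻ t, ENNReal.ofReal (cutoff n t) ∂k) atTop
      (𝓝 (∫⁻ _, ENNReal.ofReal 1 ∂k)) := by
    refine lintegral_tendsto_of_tendsto_of_monotone
      (fun n => (cutoff n).continuous.measurable.ennreal_ofReal.aemeasurable)
      (Eventually.of_forall fun t m n h => ENNReal.ofReal_le_ofReal (cutoff_mono t h))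
      (Eventually.of_forall fun t => (ENNReal.continuous_ofReal.tendsto _).comp (cutoff_tendsto_one t))
  have h3 : Tendsto (fun n => ∫⁻ t, ENNReal.ofReal (cutoff n t) ∂k) atTop (𝓝 1) := by
    have h := (ENNReal.continuous_ofReal.tendsto _).comp h1
    rw [ENNReal.ofReal_one] at h
    refine h.congr fun n => ?_
    exact ofReal_integral_eq_lintegral_ofReal
      ((cutoff n).continuous.integrable_of_hasCompactSupport (cutoff n).hasCompactSupport)
      (Eventually.of_forall fun t => cutoff_nonneg n t)
  have h4 := tendsto_nhds_unique h2 h3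
  rw [ENNReal.ofReal_one, lintegral_const, one_mul] at h4
  exact ⟨h4⟩

/-- Vague convergence of probability measures to a probability measure implies weak convergence. -/
theorem tendsto_integral_of_vague {k : Measure ℝ} [IsProbabilityMeasure k] {kL : ℕ → Measure ℝ}
    (hp : ∀ L, 0 < L → IsProbabilityMeasure (kL L))
    (hv : ∀ g : C_c(ℝ, ℂ), Tendsto (fun L => ∫ t, g t ∂(kL L)) atTop (𝓝 (∫ t, g t ∂k)))
    (f : ℝ →ᵇ ℂ) : Tendsto (fun L => ∫ t, f t ∂(kL L)) atTop (𝓝 (∫ t, f t ∂k)) := by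
  have hvr : ∀ g : C_c(ℝ, ℝ), Tendsto (fun L => ∫ t, g t ∂(kL L)) atTop (𝓝 (∫ t, g t ∂k)) := by
    intro g
    have h := (Complex.continuous_re.tendsto _).comp (hv (complexify g))
    have hre : ∀ μ : Measure ℝ, (∫ t, complexify g t ∂μ).re = ∫ t, g t ∂μ := by
      intro μ
      simp only [complexify_apply]
      rw [show ∫ t, (g t : ℂ) ∂μ = ((∫ t, g t ∂μ : ℝ) : ℂ) from integral_ofReal, Complex.ofReal_re]
    rw [hre] at h
    exact h.congr fun L => hre _
  have hcut : Tendsto (fun n => ∫ t, cutoff n t ∂k) atTop (𝓝 1) := by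
    have h : Tendsto (fun n => ∫ t, cutoff n t ∂k) atTop (𝓝 (∫ _, (1 : ℝ) ∂k)) := by
      refine tendsto_integral_of_dominated_convergence (fun _ => 1)
        (fun n => (cutoff n).continuous.aestronglyMeasurable) (integrable_const _)
        (fun n => Eventually.of_forall fun t => ?_) (Eventually.of_forall cutoff_tendsto_one)
      rw [Real.norm_of_nonneg (cutoff_nonneg n t)]
      exact cutoff_le_one n t
    simpa using h
  -- The tail of f is controlled by the mass missed by the cutoff, itself the integral of a
  -- compactly supported function.
  have hdiff : ∀ (μ : Measure ℝ) [IsProbabilityMeasure μ] (n : ℕ),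
      ‖∫ t, f t ∂μ - ∫ t, (cutoff n t : ℂ) * f t ∂μ‖ ≤ ‖f‖ * (1 - ∫ t, cutoff n t ∂μ) := by
    intro μ _ n
    have hf : Integrable f μ := f.integrable μ
    have hc : Integrable (fun t => cutoff n t) μ :=
      (cutoff n).continuous.integrable_of_hasCompactSupport (cutoff n).hasCompactSupport
    have hcf : Integrable (fun t => (cutoff n t : ℂ) * f t) μ := by
      refine hf.mono ((Complex.continuous_ofReal.comp (cutoff n).continuous).mul
        f.continuous).aestronglyMeasurable (Eventually.of_forall fun t => ?_)
      rw [norm_mul, Complex.norm_real, Real.norm_of_nonneg (cutoff_nonneg n t)]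
      exact mul_le_of_le_one_left (norm_nonneg _) (cutoff_le_one n t)
    have h1 : ∫ t, (‖f‖ * (1 - cutoff n t)) ∂μ = ‖f‖ * (1 - ∫ t, cutoff n t ∂μ) := by
      rw [integral_const_mul, integral_sub (integrable_const _) hc]
      simp
    rw [← integral_sub hf hcf, ← h1]
    refine norm_integral_le_of_norm_le (((integrable_const _).sub hc).const_mul _)
      (Eventually.of_forall fun t => ?_)
    have h2 : f t - (cutoff n t : ℂ) * f t = f t * ((1 - cutoff n t : ℝ) : ℂ) := by
      push_cast
      ring
    rw [h2, norm_mul, Complex.norm_real, Real.norm_of_nonneg (sub_nonneg.2 (cutoff_le_one n t))]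
    exact mul_le_mul_of_nonneg_right (f.norm_coe_le_norm t) (sub_nonneg.2 (cutoff_le_one n t))
  have hcf : ∀ n, Tendsto (fun L => ∫ t, (cutoff n t : ℂ) * f t ∂(kL L)) atTop
      (𝓝 (∫ t, (cutoff n t : ℂ) * f t ∂k)) := by
    intro n
    let g : C_c(ℝ, ℂ) :=
      { toFun := fun t => complexify (cutoff n) t * f t
        continuous_toFun := (complexify (cutoff n)).continuous.mul f.continuous
        hasCompactSupport' := (complexify (cutoff n)).hasCompactSupport.mul_right }
    have hg : ∀ t, g t = (cutoff n t : ℂ) * f t := fun t =>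
      congrArg (· * f t) (complexify_apply (cutoff n) t)
    have := hv g
    simpa only [hg] using this
  rw [Metric.tendsto_atTop']
  intro η hη
  set M := ‖f‖ + 1 with hM
  have hM0 : 0 < M := by positivity
  have hfM : ‖f‖ ≤ M := by linarith
  have hη' : 0 < η / (8 * M) := by positivity
  -- The cutoff is chosen for k alone; vague convergence passes the strict bound to k_L for large L,
  -- which is tightness. The errors add up to η/8 + η/4 + η/8 < η.
  obtain ⟨n, hn⟩ := (hcut.eventually (lt_mem_nhds (show 1 - η / (8 * M) < 1 by linarith))).exists
  have h1 := (hvr (cutoff n)).eventually (lt_mem_nhds hn)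
  have h2 := (Metric.tendsto_nhds.1 (hcf n)) (η / 4) (by positivity)
  obtain ⟨N, hN⟩ := eventually_atTop.1 (h1.and (h2.and (eventually_gt_atTop 0)))
  refine ⟨N, fun L hL => ?_⟩
  obtain ⟨h3, h4, h5⟩ := hN L hL.le
  have := hp L h5
  have hb : ∀ x : ℝ, 1 - η / (8 * M) < x → x ≤ 1 → ‖f‖ * (1 - x) ≤ η / 8 := by
    intro x hx hx1
    calc ‖f‖ * (1 - x) ≤ M * (η / (8 * M)) :=
          mul_le_mul hfM (by linarith) (by linarith) hM0.le
      _ = η / 8 := by field_simp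
  have hone : ∀ (μ : Measure ℝ) [IsProbabilityMeasure μ], ∫ t, cutoff n t ∂μ ≤ 1 := by
    intro μ _
    have : ∫ t, cutoff n t ∂μ ≤ ∫ _, (1 : ℝ) ∂μ :=
      integral_mono ((cutoff n).continuous.integrable_of_hasCompactSupport
        (cutoff n).hasCompactSupport) (integrable_const _) (cutoff_le_one n)
    simpa using this
  have h6 := (hdiff (kL L) n).trans (hb _ h3 (hone _))
  have h7 := (hdiff k n).trans (hb _ hn (hone _))
  rw [← dist_eq_norm] at h6 h7
  rw [dist_comm] at h7
  have h8 := dist_triangle4 (∫ t, f t ∂(kL L)) (∫ t, (cutoff n t : ℂ) * f t ∂(kL L))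
    (∫ t, (cutoff n t : ℂ) * f t ∂k) (∫ t, f t ∂k)
  linarith

theorem norm_cutoff_le (n : ℕ) (t : ℝ) : ‖complexify (cutoff n) t‖ ≤ 1 := by
  rw [complexify_apply, Complex.norm_real, Real.norm_of_nonneg (cutoff_nonneg n t)]
  exact cutoff_le_one n t

section SelfAdjoint

variable {E : Type*} [NormedAddCommGroup E] [InnerProductSpace ℂ E] [CompleteSpace E]
  {A : E →ₗ.[ℂ] E}

theorem circleLift_add (f g : C₀(ℝ, ℂ)) : circleLift (f + g) = circleLift f + circleLift g := by
  ext w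
  rw [ContinuousMap.add_apply]
  simp only [circleLift_apply, ZeroAtInftyContinuousMap.add_apply]
  split_ifs <;> simp

theorem circleLift_smul (c : ℂ) (f : C₀(ℝ, ℂ)) : circleLift (c • f) = c • circleLift f := by
  ext w
  rw [ContinuousMap.smul_apply]
  simp only [circleLift_apply, ZeroAtInftyContinuousMap.smul_apply]
  split_ifs <;> simp

theorem norm_inner_applyFun_le (hA : IsSelfAdjoint A) (g : C₀(ℝ, ℂ)) {ψ : E} (hψ : ‖ψ‖ = 1) :
    ‖⟪ψ, applyFun g A ψ⟫_ℂ‖ ≤ ‖circleLift g‖ := by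
  refine (norm_inner_le_norm _ _).trans ?_
  rw [hψ, one_mul, applyFun_eq_resolventCalculus hA]
  refine (ContinuousLinearMap.le_opNorm _ _).trans ?_
  rw [hψ, mul_one]
  exact norm_resolventCalculus_le hA _

theorem norm_inner_applyFun_sub_applyFun_le (hA : IsSelfAdjoint A) (g g' : C₀(ℝ, ℂ)) {ψ : E}
    (hψ : ‖ψ‖ = 1) :
    ‖⟪ψ, applyFun g A ψ⟫_ℂ - ⟪ψ, applyFun g' A ψ⟫_ℂ‖ ≤ ‖circleLift g - circleLift g'‖ := by
  rw [← inner_sub_right, applyFun_eq_resolventCalculus hA, applyFun_eq_resolventCalculus hA,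
    ← sub_apply, ← map_sub]
  refine (norm_inner_le_norm _ _).trans ?_
  rw [hψ, one_mul]
  refine (ContinuousLinearMap.le_opNorm _ _).trans ?_
  rw [hψ, mul_one]
  exact norm_resolventCalculus_le hA _

/-- The domain condition serves only the total mass: the deficit of the n-th cutoff is at most ‖(A -
i)ψ‖/(n + 1). -/
theorem isStateFunctional_inner_applyFun (hA : IsSelfAdjoint A) {ψ : E} (hψ : ‖ψ‖ = 1)
    (hd : ψ ∈ A.domain) : IsStateFunctional fun g => ⟪ψ, applyFun g A ψ⟫_ℂ where
  add f g := by
    rw [applyFun_eq_resolventCalculus hA, applyFun_eq_resolventCalculus hA,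
      applyFun_eq_resolventCalculus hA, circleLift_add, map_add, add_apply, inner_add_right]
  smul c f := by
    rw [applyFun_eq_resolventCalculus hA, applyFun_eq_resolventCalculus hA,
      circleLift_smul, map_smul, smul_apply, inner_smul_right]
  nonneg f hf := inner_applyFun_nonneg hA hf ψ
  tendsto_cutoff := by
    have h1 : ∀ n : ℕ, ‖⟪ψ, applyFun (complexify (cutoff n)) A ψ⟫_ℂ - 1‖ ≤
        ((n : ℝ) + 1)⁻¹ * ‖A ⟨ψ, hd⟩ - Complex.I • ψ‖ := by
      intro n
      have h2 := norm_inner_applyFun_sub_le hA (g := (complexify (cutoff n) : C₀(ℝ, ℂ)))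
        (r := (n : ℝ) + 1) (by positivity)
        (fun t ht => (complexify_apply _ _).trans (by rw [cutoff_eq_one ht, Complex.ofReal_one]))
        (fun t => by
          change ‖1 - complexify (cutoff n) t‖ ≤ 1
          rw [complexify_apply, ← Complex.ofReal_one, ← Complex.ofReal_sub, Complex.norm_real,
            Real.norm_of_nonneg (sub_nonneg.2 (cutoff_le_one n t))]
          linarith [cutoff_nonneg n t]) ⟨ψ, hd⟩
      simp only [hψ, one_mul] at h2
      rw [inner_self_eq_norm_sq_to_K, hψ, norm_sub_rev] at h2
      simpa using h2
    rw [tendsto_iff_norm_sub_tendsto_zero]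
    refine squeeze_zero (fun _ => norm_nonneg _) h1 ?_
    have h3 := (tendsto_one_div_add_atTop_nhds_zero_nat (𝕜 := ℝ)).mul_const
      ‖A ⟨ψ, hd⟩ - Complex.I • ψ‖
    simpa using h3

end SelfAdjoint

theorem IsStateFunctional.average {ι : Type*} {s : Finset ι} (hs : s.Nonempty)
    {J : ι → (ℝ → ℂ) → ℂ} (hJ : ∀ x ∈ s, IsStateFunctional (J x)) :
    IsStateFunctional fun g => (s.card : ℂ)⁻¹ * ∑ x ∈ s, J x g where
  add f g := by
    rw [← mul_add, ← Finset.sum_add_distrib, Finset.sum_congr rfl fun x hx => (hJ x hx).add f g]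
  smul c f := by
    rw [mul_left_comm, Finset.mul_sum _ _ c,
      Finset.sum_congr rfl fun x hx => (hJ x hx).smul c f]
  nonneg f hf := by
    refine mul_nonneg ?_ (Finset.sum_nonneg fun x hx => (hJ x hx).nonneg f hf)
    rw [← Complex.ofReal_natCast, ← Complex.ofReal_inv]
    exact_mod_cast inv_nonneg.2 (Nat.cast_nonneg (α := ℝ) s.card)
  tendsto_cutoff := by
    have h := (tendsto_finsetSum s fun x hx => (hJ x hx).tendsto_cutoff).const_mul
      ((s.card : ℂ)⁻¹)
    have h0 : (s.card : ℂ) ≠ 0 := by exact_mod_cast hs.card_pos.ne'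
    simpa [h0] using h

theorem IsStateFunctional.expectation {Ω : Type*} [MeasurableSpace Ω] {P : Measure Ω}
    [IsProbabilityMeasure P] {J : Ω → (ℝ → ℂ) → ℂ} (hJ : ∀ ω, IsStateFunctional (J ω))
    (hint : ∀ g : C₀(ℝ, ℂ), Integrable (fun ω => J ω g) P)
    (hle : ∀ ω n, ‖J ω (complexify (cutoff n))‖ ≤ 1) :
    IsStateFunctional fun g => ∫ ω, J ω g ∂P where
  add f g := by
    rw [← integral_add (hint f) (hint g)]
    exact integral_congr_ae (Eventually.of_forall fun ω => (hJ ω).add f g)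
  smul c f := by
    rw [← integral_const_mul]
    exact integral_congr_ae (Eventually.of_forall fun ω => (hJ ω).smul c f)
  nonneg f hf := integral_nonneg fun ω => (hJ ω).nonneg f hf
  tendsto_cutoff := by
    have h : Tendsto (fun n => ∫ ω, J ω (complexify (cutoff n)) ∂P) atTop
        (𝓝 (∫ _, (1 : ℂ) ∂P)) :=
      tendsto_integral_of_dominated_convergence (fun _ => 1)
        (fun n => (hint (complexify (cutoff n) : C₀(ℝ, ℂ))).1) (integrable_const _)
        (fun n => Eventually.of_forall fun ω => hle ω n)
        (Eventually.of_forall fun ω => (hJ ω).tendsto_cutoff)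
    simpa using h

end StateFunctional

/-! ### Ergodic averages of diagonal matrix elements -/

section ErgodicOperator

theorem box_nonempty (L : ℕ) : (box L).Nonempty :=
  ⟨0, by simp [box]⟩

theorem isStateFunctional_boxAverage {A : EllTwo →ₗ.[ℂ] EllTwo} (hA : IsSelfAdjoint A)
    (hdom : ∀ x, deltaVec x ∈ A.domain) (L : ℕ) : IsStateFunctional (boxAverage A L) :=
  IsStateFunctional.average (box_nonempty L) fun x _ =>
    isStateFunctional_inner_applyFun (isSelfAdjoint_truncation hA hdom L) (norm_deltaVec x)
      (by
        rw [truncation_domain hdom]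
        trivial)

variable {Ω : Type*} [MeasurableSpace Ω] {P : Measure Ω} {T : ℤ → Ω → Ω}
  {H : Ω → (EllTwo →ₗ.[ℂ] EllTwo)}

theorem IsRandomOperator.integrable_inner_applyFun [IsProbabilityMeasure P]
    (hH : IsRandomOperator P H) (g : C₀(ℝ, ℂ)) :
    Integrable (fun ω => ⟪deltaVec 0, applyFun g (H ω) (deltaVec 0)⟫_ℂ) P :=
  (integrable_const ‖circleLift g‖).mono'
    (hH.weaklyMeasurable g (deltaVec 0) (deltaVec 0)).aestronglyMeasurable
    (Eventually.of_forall fun ω =>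
      norm_inner_applyFun_le (hH.selfAdjoint ω) g (norm_deltaVec 0))

theorem isStateFunctional_expectation [IsProbabilityMeasure P] (hH : IsRandomOperator P H)
    (hdom : ∀ (ω : Ω) (x : ℤ), deltaVec x ∈ (H ω).domain) :
    IsStateFunctional fun g => ∫ ω, ⟪deltaVec 0, applyFun g (H ω) (deltaVec 0)⟫_ℂ ∂P :=
  IsStateFunctional.expectation
    (fun ω => isStateFunctional_inner_applyFun (hH.selfAdjoint ω) (norm_deltaVec 0) (hdom ω 0))
    hH.integrable_inner_applyFun fun ω n =>
      (norm_inner_applyFun_le (hH.selfAdjoint ω) (complexify (cutoff n) : C₀(ℝ, ℂ))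
        (norm_deltaVec 0)).trans (norm_circleLift_le zero_le_one (norm_cutoff_le n))

/-- Stationarity of the diagonal matrix elements. -/
theorem IsErgodicOperator.inner_applyFun_shift (hH : IsErgodicOperator P T H) (g : C₀(ℝ, ℂ))
    (x : ℤ) (ω : Ω) :
    ⟪deltaVec 0, applyFun g (H (T (-x) ω)) (deltaVec 0)⟫_ℂ =
      ⟪deltaVec x, applyFun g (H ω) (deltaVec x)⟫_ℂ := by
  obtain ⟨U, φ, hU, hconj⟩ := hH.covariant (-x) ω
  set c := Complex.exp (Complex.I * φ 0) with hc
  have hcn : starRingEnd ℂ c * c = 1 := by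
    rw [← Complex.normSq_eq_conj_mul_self, Complex.normSq_eq_norm_sq, hc, mul_comm Complex.I,
      Complex.norm_exp_ofReal_mul_I]
    norm_num
  -- U translates by -x, so it carries δ_x to δ_0 up to the phase at 0; the phase cancels in a
  -- diagonal element.
  have hUδ : U (deltaVec x) = c • deltaVec 0 := by
    ext ξ
    rw [hU, lp.coeFn_smul, Pi.smul_apply, deltaVec, deltaVec, smul_eq_mul]
    by_cases hξ : ξ = 0
    · subst hξ
      rw [zero_sub, neg_neg, lp.single_apply_self, lp.single_apply_self, hc]
      ring
    · rw [lp.single_apply_ne _ _ _ hξ, lp.single_apply_ne, mul_zero, zero_mul]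
      intro h
      apply hξ
      linarith
  have hsymm : U.symm (deltaVec 0) = starRingEnd ℂ c • deltaVec x := by
    rw [U.symm_apply_eq, map_smul, hUδ, smul_smul, hcn, one_smul]
  rw [applyFun_eq_resolventCalculus (hH.selfAdjoint _),
    applyFun_eq_resolventCalculus (hH.selfAdjoint ω),
    resolventCalculus_conj (hH.selfAdjoint ω) (hH.selfAdjoint _) U hconj,
    LinearIsometryEquiv.conjStarAlgEquiv_apply_apply, ← U.symm.inner_map_map, U.symm_apply_apply,
    hsymm, map_smul, inner_smul_left, inner_smul_right, ← mul_assoc, Complex.conj_conj, mul_comm c,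
    hcn, one_mul]

/-- C(circle) is separable, hence so is the set of lifts. Density in this norm suffices, because it
dominates all matrix elements at unit vectors. -/
theorem exists_countable_dense_circleLift :
    ∃ D : Set C₀(ℝ, ℂ), D.Countable ∧
      ∀ g : C₀(ℝ, ℂ), ∀ η > 0, ∃ g' ∈ D, ‖circleLift g - circleLift g'‖ < η := by
  obtain ⟨s, hs, hd⟩ := TopologicalSpace.exists_countable_dense (Set.range circleLift)
  choose r hr using fun y : Set.range circleLift => y.2
  refine ⟨r '' s, hs.image r, fun g η hη => ?_⟩
  obtain ⟨y, hy, hlt⟩ := hd.exists_dist_lt ⟨circleLift g, g, rfl⟩ hη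
  refine ⟨r y, ⟨y, hy, rfl⟩, ?_⟩
  rw [hr, ← dist_eq_norm]
  exact hlt

/-- The ergodic theorem is used only for the countable family. Averages and limit are both
1-Lipschitz in the lifted function, so an η/3 argument reaches every g off the same null set. -/
theorem IsErgodicOperator.ae_tendsto_average [IsProbabilityMeasure P]
    (hH : IsErgodicOperator P T H) :
    ∀ᵐ ω ∂P, ∀ g : C₀(ℝ, ℂ), Tendsto
      (fun L => ((box L).card : ℂ)⁻¹ *
        ∑ x ∈ box L, ⟪deltaVec x, applyFun g (H ω) (deltaVec x)⟫_ℂ) atTop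
      (𝓝 (∫ ω', ⟪deltaVec 0, applyFun g (H ω') (deltaVec 0)⟫_ℂ ∂P)) := by
  obtain ⟨D, hD, hdense⟩ := exists_countable_dense_circleLift
  have hint := hH.toIsRandomOperator.integrable_inner_applyFun
  have h1 := (ae_ball_iff hD).2 fun g _ =>
    hH.toIsErgodicShiftGroup.ae_tendsto_box_average (hint g)
  filter_upwards [h1] with ω h1 g
  rw [Metric.tendsto_atTop']
  intro η hη
  obtain ⟨g', hg', hlt⟩ := hdense g (η / 3) (by positivity)
  have h2 := h1 g' hg'
  simp only [hH.inner_applyFun_shift] at h2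
  obtain ⟨N, hN⟩ := Metric.tendsto_atTop'.1 h2 (η / 3) (by positivity)
  refine ⟨N, fun L hL => ?_⟩
  have h3 : dist (((box L).card : ℂ)⁻¹ *
        ∑ x ∈ box L, ⟪deltaVec x, applyFun g (H ω) (deltaVec x)⟫_ℂ)
      (((box L).card : ℂ)⁻¹ *
        ∑ x ∈ box L, ⟪deltaVec x, applyFun g' (H ω) (deltaVec x)⟫_ℂ) ≤ η / 3 := by
    have hc : (0 : ℝ) < (box L).card := by
      exact_mod_cast (box_nonempty L).card_pos
    rw [dist_eq_norm, ← mul_sub, ← Finset.sum_sub_distrib, norm_mul, norm_inv,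
      Complex.norm_natCast, inv_mul_le_iff₀ hc, ← nsmul_eq_mul]
    refine (norm_sum_le _ _).trans (Finset.sum_le_card_nsmul _ _ _ fun x _ => ?_)
    exact (norm_inner_applyFun_sub_applyFun_le (hH.selfAdjoint ω) g g' (norm_deltaVec x)).trans
      hlt.le
  have h4 : dist (∫ ω', ⟪deltaVec 0, applyFun g' (H ω') (deltaVec 0)⟫_ℂ ∂P)
      (∫ ω', ⟪deltaVec 0, applyFun g (H ω') (deltaVec 0)⟫_ℂ ∂P) ≤ η / 3 := by
    rw [dist_comm, dist_eq_norm, ← integral_sub (hint g) (hint g')]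
    refine (norm_integral_le_of_norm_le_const (C := η / 3) (Eventually.of_forall fun ω' =>
      (norm_inner_applyFun_sub_applyFun_le (hH.selfAdjoint ω') g g' (norm_deltaVec 0)).trans
        hlt.le)).trans ?_
    simp
  have h5 := hN L hL
  have h6 := dist_triangle4 (((box L).card : ℂ)⁻¹ *
        ∑ x ∈ box L, ⟪deltaVec x, applyFun g (H ω) (deltaVec x)⟫_ℂ)
      (((box L).card : ℂ)⁻¹ *
        ∑ x ∈ box L, ⟪deltaVec x, applyFun g' (H ω) (deltaVec x)⟫_ℂ)
      (∫ ω', ⟪deltaVec 0, applyFun g' (H ω') (deltaVec 0)⟫_ℂ ∂P)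
      (∫ ω', ⟪deltaVec 0, applyFun g (H ω') (deltaVec 0)⟫_ℂ ∂P)
  linarith

end ErgodicOperator

/-! ### The theorem -/

theorem mainTheorem2 {Ω : Type*} [MeasurableSpace Ω] (P : Measure Ω) [IsProbabilityMeasure P]
    (T : ℤ → Ω → Ω) (H : Ω → (EllTwo →ₗ.[ℂ] EllTwo)) (hH : IsErgodicOperator P T H)
    (hdom : ∀ (ω : Ω) (x : ℤ), deltaVec x ∈ (H ω).domain)
    (ε : ℕ → ℝ) (hε : Tendsto ε atTop (𝓝 0))
    (htr : ∀ (ω : Ω) (L : ℕ), 0 < L →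
      TraceClassWithBound (truncation (H ω) L - (boxProj L).compPMap (H ω))
        (ε L * ((box L).card : ℝ))) :
    (∃! k : Measure ℝ, IsDOSMeasure P H k) ∧
    (∀ (ω : Ω) (L : ℕ), 0 < L → ∃! k : Measure ℝ, IsFiniteVolumeDOSMeasure (H ω) L k) ∧
    (∀ g : C₀(ℝ, ℂ),
      Integrable (fun ω => ⟪deltaVec 0, applyFun g (H ω) (deltaVec 0)⟫_ℂ) P) ∧
    ∃ Ω₀ : Set Ω, MeasurableSet Ω₀ ∧ P Ω₀ = 1 ∧
      (∀ ω ∈ Ω₀, ∀ g : C₀(ℝ, ℂ),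
        Tendsto (fun L : ℕ => boxAverage (H ω) L g) atTop
          (𝓝 (∫ ω', ⟪deltaVec 0, applyFun g (H ω') (deltaVec 0)⟫_ℂ ∂P))) ∧
      (∀ ω ∈ Ω₀, ∀ (k : Measure ℝ) (kL : ℕ → Measure ℝ), IsDOSMeasure P H k →
        (∀ L : ℕ, 0 < L → IsFiniteVolumeDOSMeasure (H ω) L (kL L)) →
        IsProbabilityMeasure k ∧ (∀ L : ℕ, 0 < L → IsProbabilityMeasure (kL L)) ∧
        ∀ f : ℝ →ᵇ ℂ,
          Tendsto (fun L : ℕ => ∫ t, f t ∂(kL L)) atTop (𝓝 (∫ t, f t ∂k))) := by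
  have hE := isStateFunctional_expectation hH.toIsRandomOperator hdom
  have hB := fun ω => isStateFunctional_boxAverage (hH.selfAdjoint ω) (hdom ω)
  refine ⟨hE.existsUnique_isRieszMeasure,
    fun ω L _ => (hB ω L).existsUnique_isRieszMeasure,
    hH.toIsRandomOperator.integrable_inner_applyFun, ?_⟩
  -- The exceptional set, a union over all g, need not be measurable, so it is enlarged to a
  -- measurable null set.
  obtain ⟨N, hN, hNm, hN0⟩ := exists_measurable_superset_of_null
    (ae_iff.1 hH.ae_tendsto_average)
  have hlim : ∀ ω ∈ Nᶜ, ∀ g : C₀(ℝ, ℂ),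
      Tendsto (fun L : ℕ => boxAverage (H ω) L g) atTop
        (𝓝 (∫ ω', ⟪deltaVec 0, applyFun g (H ω') (deltaVec 0)⟫_ℂ ∂P)) := by
    intro ω hω g
    have h1 := not_not.1 fun h => hω (hN h)
    have h2 := (tendsto_boxAverage_sub (hH.selfAdjoint ω) (hdom ω) hε (htr ω) g).add (h1 g)
    simpa using h2
  refine ⟨Nᶜ, hNm.compl, (prob_compl_eq_one_iff hNm).2 hN0, hlim, ?_⟩
  intro ω hω k kL hk hkL
  have hkp : IsProbabilityMeasure k := hE.isProbabilityMeasure hk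
  have hkLp : ∀ L, 0 < L → IsProbabilityMeasure (kL L) := fun L hL =>
    (hB ω L).isProbabilityMeasure (hkL L hL)
  refine ⟨hkp, hkLp, fun f => tendsto_integral_of_vague hkLp (fun g => ?_) f⟩
  rw [hk.2 g]
  refine (hlim ω hω (g : C₀(ℝ, ℂ))).congr' ?_
  filter_upwards [eventually_gt_atTop 0] with L hL
  exact ((hkL L hL).2 g).symm
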